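/- **Setting.** Let $(\Omega,\Sigma,\mathbb P)$ be a probability space and let $(\mathbf a_n,b_n)_{n\ge1}$ be square-integrable random variables in $\mathbb R^D\times\mathbb R$ that follow the linear-regression model $b_n=\mathbf a_n^{\top}\boldsymbol\theta_*+\eta_n$ a.s., where the noise process $(\eta_n)_n$ is zero-mean and independent of the process $(\mathbf a_n)_n$, and where $\mathbf R=\mathbb E(\mathbf a_n\mathbf a_n^{\top})$, $\mathbf r=\mathbb E(b_n\mathbf a_n)$ and $\mathbb E(b_n^2)$ do not depend on $n$. For $n\ge 1$ put $\mathbf R_n=\frac1n\sum_{\nu=1}^n\mathbf a_\nu\mathbf a_\nu^{\top}$, $\mathbf r_n=\frac1n\sum_{\nu=1}^n b_\nu\mathbf a_\nu$, and $$l(\mathbf x)=\tfrac12\mathbf x^{\top}\mathbf R\mathbf x-\mathbf r^{\top}\mathbf x+\tfrac12\mathbb E(b_n^2),\qquad l_n(\mathbf x)=\tfrac1{2n}\sum_{\nu=1}^n(\mathbf a_\nu^{\top}\mathbf x-b_\nu)^2 .$$ For $\rho>0$ consider the problem $$\min_{\mathbf x\in\mathbb R^D}\ l(\mathbf x)+\rho\|\mathbf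 x\|_1 .\tag{CRegLS}$$ **Algorithm.** Let $\mathcal X=\mathbb R^D\times\mathbb R^D$ with its product inner product, and let $P(\mathsf x^{(1)},\mathsf x^{(2)})=\bigl(\tfrac12(\mathsf x^{(1)}+\mathsf x^{(2)}),\tfrac12(\mathsf x^{(1)}+\mathsf x^{(2)})\bigr)$ be the orthogonal projection onto the diagonal $\mathcal A=\{\mathsf x^{(1)}=\mathsf x^{(2)}\}$. Fix $\alpha\in[\frac12,1)$, $\lambda>0$, $x_0\in\mathcal X$, a vector $\mathbf r_0\in\mathbb R^D$ and a matrix $\mathbf R_0\in\mathbb R^{D\times D}$ such that $\mathbf I+\lambda\mathbf R_0$ is invertible. Set $x_{1/2}=\alpha Px_0+(1-\alpha)x_0$ and, for $n\ge0$, $$\mathsf x^{(1)}_{n+1}=(\mathbf I+\lambda\mathbf R_n)^{-1}\bigl(\mathsf x^{(1)}_{n+1/2}+\lambda\mathbf r_n\bigr),\qquad [\mathsf x^{(2)}_{n+1}]_d=[\mathsf x^{(2)}_{n+1/2}]_d\Bigl(1-\frac{\lambda\rho}{\max\{\lambda\rho,|[\mathsf x^{(2)}_{n+1/2}]_d|\}}\Bigr)\quad(1\le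 d\le D),$$ $$x_{n+1}=(\mathsf x^{(1)}_{n+1},\mathsf x^{(2)}_{n+1}),\qquad x_{n+3/2}=x_{n+1/2}-\alpha Px_n-(1-\alpha)x_n+Px_{n+1}.$$ The output sequence is $\mathbf x_n=\tfrac12(\mathsf x_n^{(1)}+\mathsf x_n^{(2)})\in\mathbb R^D$. **Notation.** Let $\mathcal F_n=\sigma(x_0,\dots,x_n)$, $h(x)=l(\mathsf x^{(1)})$, $h_n(x)=l_n(\mathsf x^{(1)})$, $g(x)=\rho\|\mathsf x^{(2)}\|_1$ for $x=(\mathsf x^{(1)},\mathsf x^{(2)})\in\mathcal X$, and $U=\mathrm{Id}-P$. Let $\Upsilon_*$ be the set of all $(x_*,v_*)\in\mathcal A\times\mathcal X$ such that $\xi_*:=-Uv_*/\lambda\in\partial(h+g)(x_*)$. With $\xi_{n+1}=(x_{n+1/2}-x_{n+1})/\lambda$, put $\vartheta_n=2\lambda\langle x_*-x_{n+1},\,\xi_{n+1}-\xi_*\rangle$ for $n\ge 0$. **Assumptions.** 1. (Pointwise ergodicity) $\mathbf R-\mathbf R_n\to0$ and $\mathbf r-\mathbf r_n\to0$ a.s.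 2. (Asymptotic unbiasedness) For every $x\in\mathcal X$, $\mathbb E[(h-h_n)(x)\mid\mathcal F_n]\to0$ a.s.; moreover $\mathbb E[(h-h_n)(x_n)\mid\mathcal F_n]\to0$ a.s. 3. (Domination) For every $(x_*,v_*)\in\Upsilon_*$ there is a nonnegative random variable $\psi$ with $\mathbb E(\psi)<\infty$ and $\sum_{n\ge 0}\max\{0,\mathbb E[\vartheta_n\mid\mathcal F_n]\}\le\psi$ a.s. **Conclusion.** The sequence $(\mathbf x_n)_n$ converges almost surely to a (possibly random) solution of (CRegLS). -/

import Mathlib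

open Filter Topology MeasureTheory ProbabilityTheory
open scoped Matrix

noncomputable section

namespace CRegLS

/-- Euclidean space `ℝ^D`. -/
abbrev E (D : ℕ) : Type := EuclideanSpace ℝ (Fin D)

/-- The Hilbert space `ℝ^D × ℝ^D` of split variables `(x⁽¹⁾, x⁽²⁾)`, with inner product
`⟪(x⁽¹⁾, x⁽²⁾), (y⁽¹⁾, y⁽²⁾)⟫ = ⟪x⁽¹⁾, y⁽¹⁾⟫ + ⟪x⁽²⁾, y⁽²⁾⟫`. -/
abbrev X (D : ℕ) : Type := WithLp 2 (E D × E D)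

/-- The pair `(u, w)` as a point of `ℝ^D × ℝ^D`. -/
def pair {D : ℕ} (u w : E D) : X D := WithLp.toLp 2 (u, w)

/-- The matrix `M` acting on the column vector `x`. -/
def mulVec {D : ℕ} (M : Matrix (Fin D) (Fin D) ℝ) (x : E D) : E D :=
  WithLp.toLp 2 (M *ᵥ x.ofLp)

/-- The `ℓ₁`-norm on `ℝ^D`. -/
def l1 {D : ℕ} (x : E D) : ℝ := ∑ d, |x d|

/-! ### The linear-regression model -/

/-- The standing assumptions on the data `(a_n, b_n)`, `n ≥ 1`: the linear-regression model
`b_n = a_nᵀ θ + η_n` almost surely, with zero-mean noise process `(η_n)_n` independent of the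
process `(a_n)_n`, where `R = E(a_n a_nᵀ)`, `r = E(b_n a_n)` and `β = E(b_n²)` (finite) do not
depend on `n`. Entries with index `0` of the sequences play no role. -/
structure RegressionModel {Ω : Type*} [MeasurableSpace Ω] (μ : Measure Ω) {D : ℕ} (θ : E D)
    (a : ℕ → Ω → E D) (b η : ℕ → Ω → ℝ)
    (R : Matrix (Fin D) (Fin D) ℝ) (r : E D) (β : ℝ) : Prop where
  measurable_a : ∀ n, 1 ≤ n → Measurable (a n)
  measurable_b : ∀ n, 1 ≤ n → Measurable (b n)
  measurable_noise : ∀ n, 1 ≤ n → Measurable (η n)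
  memLp_a : ∀ n, 1 ≤ n → MemLp (a n) 2 μ
  memLp_b : ∀ n, 1 ≤ n → MemLp (b n) 2 μ
  regression : ∀ n, 1 ≤ n → ∀ᵐ ω ∂μ, b n ω = inner ℝ (a n ω) θ + η n ω
  noise_mean : ∀ n, 1 ≤ n → ∫ ω, η n ω ∂μ = 0
  noise_indep : IndepFun (fun ω (k : ℕ) => η (k + 1) ω) (fun ω (k : ℕ) => a (k + 1) ω) μ
  moment_R : ∀ n, 1 ≤ n → ∀ i j, ∫ ω, a n ω i * a n ω j ∂μ = R i j
  moment_r : ∀ n, 1 ≤ n → ∀ i, ∫ ω, b n ω * a n ω i ∂μ = r i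
  moment_b : ∀ n, 1 ≤ n → ∫ ω, b n ω ^ 2 ∂μ = β

/-- The ensemble least-squares loss `l(x) = ½ xᵀ R x - rᵀ x + ½ β`, with `β = E(b_n²)`. -/
def ensembleLoss {D : ℕ} (R : Matrix (Fin D) (Fin D) ℝ) (r : E D) (β : ℝ) (x : E D) : ℝ :=
  1 / 2 * inner ℝ x (mulVec R x) - inner ℝ r x + 1 / 2 * β

/-- The empirical loss `l_n(x) = 1/(2n) ∑_{ν = 1}^n (a_νᵀ x - b_ν)²`, `n ≥ 1`. -/
def empiricalLoss {Ω : Type*} {D : ℕ} (a : ℕ → Ω → E D) (b : ℕ → Ω → ℝ) (n : ℕ) (ω : Ω)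
    (x : E D) : ℝ :=
  1 / (2 * (n : ℝ)) * ∑ ν ∈ Finset.Icc 1 n, (inner ℝ (a ν ω) x - b ν ω) ^ 2

/-- `x` solves the `ℓ₁`-regularized least-squares problem `min l(x) + ρ ‖x‖₁` over `ℝ^D`. -/
def IsSolution {D : ℕ} (R : Matrix (Fin D) (Fin D) ℝ) (r : E D) (β ρ : ℝ) (x : E D) : Prop :=
  ∀ z : E D, ensembleLoss R r β x + ρ * l1 x ≤ ensembleLoss R r β z + ρ * l1 z

/-! ### The algorithm -/

/-- The user's input: `α ∈ [1/2, 1)`, `λ > 0`, the regularization coefficient `ρ > 0`, and the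
fixed `R₀`, `r₀`, `x₀ = (x₀⁽¹⁾, x₀⁽²⁾)`. Invertibility of `I + λ R₀` is what the first step
needs to be defined. -/
structure Input (D : ℕ) where
  α : ℝ
  lam : ℝ
  ρ : ℝ
  R0 : Matrix (Fin D) (Fin D) ℝ
  r0 : E D
  x0 : X D
  half_le_α : 1 / 2 ≤ α
  α_lt_one : α < 1
  lam_pos : 0 < lam
  ρ_pos : 0 < ρ
  isUnit_R0 : IsUnit (1 + lam • R0)

/-- `R_n = (1/n) ∑_{ν = 1}^n a_ν a_νᵀ` for `n ≥ 1`, and `R_0` is the user's choice. -/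
def Rn {Ω : Type*} {D : ℕ} (p : Input D) (a : ℕ → Ω → E D) (n : ℕ) (ω : Ω) :
    Matrix (Fin D) (Fin D) ℝ :=
  if n = 0 then p.R0
  else (1 / (n : ℝ)) • ∑ ν ∈ Finset.Icc 1 n, Matrix.vecMulVec (a ν ω).ofLp (a ν ω).ofLp

/-- `r_n = (1/n) ∑_{ν = 1}^n b_ν a_ν` for `n ≥ 1`, and `r_0` is the user's choice. -/
def rn {Ω : Type*} {D : ℕ} (p : Input D) (a : ℕ → Ω → E D) (b : ℕ → Ω → ℝ) (n : ℕ) (ω : Ω) :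
    E D :=
  if n = 0 then p.r0 else (1 / (n : ℝ)) • ∑ ν ∈ Finset.Icc 1 n, b ν ω • a ν ω

/-- Soft-thresholding, `[soft τ u]_d = u_d (1 - τ / max {τ, |u_d|})`. -/
def soft {D : ℕ} (τ : ℝ) (u : E D) : E D :=
  WithLp.toLp 2 fun d => u d * (1 - τ / max τ |u d|)

/-- The average `(x⁽¹⁾ + x⁽²⁾) / 2`. -/
def avg {D : ℕ} (x : X D) : E D := (1 / 2 : ℝ) • (x.fst + x.snd)

/-- The orthogonal projection onto the diagonal `{(x⁽¹⁾, x⁽²⁾) | x⁽¹⁾ = x⁽²⁾}`. -/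
def P {D : ℕ} (x : X D) : X D := pair (avg x) (avg x)

/-- The pair `(x_n, x_{n + 1/2})` of points of `ℝ^D × ℝ^D` produced by the algorithm:
`x_{1/2} = α P x_0 + (1 - α) x_0`, and for `n ≥ 0`
`x_{n+1}⁽¹⁾ = (I + λ R_n)⁻¹ (x_{n+1/2}⁽¹⁾ + λ r_n)`, `x_{n+1}⁽²⁾ = soft (λ ρ) x_{n+1/2}⁽²⁾`,
`x_{n+3/2} = x_{n+1/2} - α P x_n - (1 - α) x_n + P x_{n+1}`. -/
def run {Ω : Type*} {D : ℕ} (p : Input D) (a : ℕ → Ω → E D) (b : ℕ → Ω → ℝ) (ω : Ω) :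
    ℕ → X D × X D
  | 0 => (p.x0, p.α • P p.x0 + (1 - p.α) • p.x0)
  | n + 1 =>
    let x := (run p a b ω n).1
    let half := (run p a b ω n).2
    let next : X D :=
      pair (mulVec (1 + p.lam • Rn p a n ω)⁻¹ (half.fst + p.lam • rn p a b n ω))
        (soft (p.lam * p.ρ) half.snd)
    (next, half - p.α • P x - (1 - p.α) • x + P next)

/-- The split iterate `(x_n⁽¹⁾, x_n⁽²⁾)`. -/
def splitIterate {Ω : Type*} {D : ℕ} (p : Input D) (a : ℕ → Ω → E D) (b : ℕ → Ω → ℝ)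
    (n : ℕ) (ω : Ω) : X D := (run p a b ω n).1

/-- The intermediate iterate `(x_{n+1/2}⁽¹⁾, x_{n+1/2}⁽²⁾)`. -/
def halfIterate {Ω : Type*} {D : ℕ} (p : Input D) (a : ℕ → Ω → E D) (b : ℕ → Ω → ℝ)
    (n : ℕ) (ω : Ω) : X D := (run p a b ω n).2

/-- The output of the algorithm, `x_n = (x_n⁽¹⁾ + x_n⁽²⁾) / 2 ∈ ℝ^D`. -/
def output {Ω : Type*} {D : ℕ} (p : Input D) (a : ℕ → Ω → E D) (b : ℕ → Ω → ℝ)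
    (n : ℕ) (ω : Ω) : E D := avg (splitIterate p a b n ω)

/-- The σ-algebra `F_n` generated by the split iterates with indices `0, …, n`. -/
abbrev pastSigma {Ω : Type*} {D : ℕ} (p : Input D) (a : ℕ → Ω → E D) (b : ℕ → Ω → ℝ) (n : ℕ) :
    MeasurableSpace Ω :=
  ⨆ ν ∈ Set.Iic n, MeasurableSpace.comap (splitIterate p a b ν) inferInstance

/-! ### The assumptions -/

/-- Pointwise ergodicity: `R - R_n → 0` and `r - r_n → 0` almost surely. -/
def PointwiseErgodic {Ω : Type*} [MeasurableSpace Ω] (μ : Measure Ω) {D : ℕ} (p : Input D)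
    (a : ℕ → Ω → E D) (b : ℕ → Ω → ℝ) (R : Matrix (Fin D) (Fin D) ℝ) (r : E D) : Prop :=
  (∀ᵐ ω ∂μ, Tendsto (fun n => R - Rn p a n ω) atTop (𝓝 0)) ∧
    ∀ᵐ ω ∂μ, Tendsto (fun n => r - rn p a b n ω) atTop (𝓝 0)

/-- Asymptotic unbiasedness of `h_n(x) = l_n(x⁽¹⁾)` as estimates of `h(x) = l(x⁽¹⁾)`:
`E[(h - h_n)(x) | F_n] → 0` almost surely for every fixed `x`, and
`E[(h - h_n)(x_n) | F_n] → 0` almost surely along the split iterates. -/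
def AsymptoticallyUnbiased {Ω : Type*} [MeasurableSpace Ω] (μ : Measure Ω) {D : ℕ} (p : Input D)
    (a : ℕ → Ω → E D) (b : ℕ → Ω → ℝ) (R : Matrix (Fin D) (Fin D) ℝ) (r : E D) (β : ℝ) : Prop :=
  (∀ x : X D, ∀ᵐ ω ∂μ, Tendsto (fun n =>
      (μ[fun ω' => ensembleLoss R r β x.fst - empiricalLoss a b n ω' x.fst | pastSigma p a b n]) ω)
      atTop (𝓝 0)) ∧
    ∀ᵐ ω ∂μ, Tendsto (fun n =>
      (μ[fun ω' => ensembleLoss R r β (splitIterate p a b n ω').fst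
          - empiricalLoss a b n ω' (splitIterate p a b n ω').fst | pastSigma p a b n]) ω)
      atTop (𝓝 0)

/-- The subdifferential of a real-valued function on `ℝ^D × ℝ^D`. -/
def subdifferential {D : ℕ} (φ : X D → ℝ) (x : X D) : Set (X D) :=
  {ξ | ∀ z, φ x + inner ℝ ξ (z - x) ≤ φ z}

/-- The function `(h + g)(x⁽¹⁾, x⁽²⁾) = l(x⁽¹⁾) + ρ ‖x⁽²⁾‖₁`. -/
def splitObjective {D : ℕ} (R : Matrix (Fin D) (Fin D) ℝ) (r : E D) (β ρ : ℝ) (x : X D) : ℝ :=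
  ensembleLoss R r β x.fst + ρ * l1 x.snd

/-- `U = Id - P`; as `P` is an orthogonal projection, this is the positive square root of
`Id - P`. -/
def U {D : ℕ} (v : X D) : X D := v - P v

/-- The set `Υ_*` of all `(x_*, v_*)` with `x_*` on the diagonal and
`- U v_* / λ ∈ ∂(h + g)(x_*)`. -/
def Upsilon {D : ℕ} (p : Input D) (R : Matrix (Fin D) (Fin D) ℝ) (r : E D) (β : ℝ) :
    Set (X D × X D) :=
  {y | y.1.fst = y.1.snd ∧
    -(p.lam⁻¹ • U y.2) ∈ subdifferential (splitObjective R r β p.ρ) y.1}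

/-- The random variable `ϑ_n = 2 λ ⟪x_* - x_{n+1}, ξ_{n+1} - ξ_*⟫` associated with
`(x_*, v_*) ∈ Υ_*`, where `ξ_{n+1} = (x_{n+1/2} - x_{n+1}) / λ` is the subgradient of `h_n + g`
at `x_{n+1}` that the proximal step produces, and `ξ_* = - U v_* / λ`. (The affine constraint is
known exactly and there is no smooth loss, so no further terms appear.) -/
def vartheta {Ω : Type*} {D : ℕ} (p : Input D) (a : ℕ → Ω → E D) (b : ℕ → Ω → ℝ)
    (y : X D × X D) (n : ℕ) (ω : Ω) : ℝ :=
  2 * p.lam * inner ℝ (y.1 - splitIterate p a b (n + 1) ω)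
    (p.lam⁻¹ • (halfIterate p a b n ω - splitIterate p a b (n + 1) ω) - -(p.lam⁻¹ • U y.2))

/-- Domination: for every `(x_*, v_*) ∈ Υ_*` there is a nonnegative integrable `ψ` with
`∑_n max {0, E[ϑ_n | F_n]} ≤ ψ` almost surely. -/
def Dominated {Ω : Type*} [MeasurableSpace Ω] (μ : Measure Ω) {D : ℕ} (p : Input D)
    (a : ℕ → Ω → E D) (b : ℕ → Ω → ℝ) (R : Matrix (Fin D) (Fin D) ℝ) (r : E D) (β : ℝ) : Prop :=
  ∀ y ∈ Upsilon p R r β, ∃ ψ : Ω → ℝ, Measurable ψ ∧ (∀ ω, 0 ≤ ψ ω) ∧ Integrable ψ μ ∧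
    ∀ᵐ ω ∂μ, ∑' n, ENNReal.ofReal (max 0 ((μ[vartheta p a b y n | pastSigma p a b n]) ω))
      ≤ ENNReal.ofReal (ψ ω)

end CRegLS

end

/-! The argument is stochastic quasi-Fejér monotonicity in primal-dual variables, followed by an
Opial argument. With `w_n = α P x_n + (1 - α) x_n - x_{n+1/2}` the recursion becomes `w_{n+1} = w_n
+ (1 - α) U x_{n+1}`, so `w_n` stays orthogonal to the diagonal and acts as a multiplier for the
constraint. For every `(x_*, v_*) ∈ Υ_*` a weighted squared distance from `(x_n, w_n)` to `(x_*, U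
v_*)` obeys, path by path, the exact identity `energy_{n+1} = energy_n - dissipation_n + ϑ_n`
(`energy_step`).

With exact data, monotonicity of the subdifferential would give `ϑ_n ≤ 0`. With empirical data the
sign is lost, and domination replaces it. Since energy and dissipation are nonnegative, the partial
sums of `ϑ_n` are bounded below by a constant, and an almost supermartingale argument
(`ae_exists_tendsto_sum_of_condExp_dominated`) makes them converge almost surely. Hence the
dissipation is summable and the energy converges (`ae_tendsto_energy`).

Vanishing dissipation and `R_n → R`, `r_n → r` put every cluster point of `(x_n, w_n)` in `Υ_*`
(`mem_Upsilon_of_tendsto`), so its primal part solves the problem. The exceptional null set depends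
on `(x_*, v_*)`; a countable dense subset of `Υ_*` is therefore used, and its energies suffice to
force convergence of `P x_n` (`tendsto_P_of_energy`). -/

namespace CRegLS

/-! ### The projection onto the diagonal -/

section Projection

variable {D : ℕ}

theorem fst_P (x : X D) : (P x).fst = avg x := rfl

theorem snd_P (x : X D) : (P x).snd = avg x := rfl

theorem X_ext {x y : X D} (h₁ : x.fst = y.fst) (h₂ : x.snd = y.snd) : x = y := by
  apply WithLp.ofLp_injective
  exact Prod.ext h₁ h₂

theorem inner_X (x y : X D) :
    inner ℝ x y = inner ℝ x.fst y.fst + inner ℝ x.snd y.snd :=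
  WithLp.prod_inner_apply x y

theorem P_add (x y : X D) : P (x + y) = P x + P y := by
  have h : avg (x + y) = avg x + avg y := by
    simp only [avg, WithLp.add_fst, WithLp.add_snd]
    module
  apply X_ext <;> simp [fst_P, snd_P, h]

theorem P_smul (c : ℝ) (x : X D) : P (c • x) = c • P x := by
  have h : avg (c • x) = c • avg x := by
    simp only [avg, WithLp.smul_fst, WithLp.smul_snd]
    module
  apply X_ext <;> simp [fst_P, snd_P, h]

theorem P_sub (x y : X D) : P (x - y) = P x - P y := by
  rw [sub_eq_add_neg, P_add, ← neg_one_smul ℝ y, P_smul, neg_one_smul, ← sub_eq_add_neg]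

theorem P_zero : P (0 : X D) = 0 := by
  simpa using P_smul 0 (0 : X D)

theorem P_eq_self {x : X D} (h : x.fst = x.snd) : P x = x := by
  have h' : avg x = x.snd := by
    rw [avg, h]
    module
  exact X_ext (by rw [fst_P, h', h]) (by rw [snd_P, h'])

theorem P_P (x : X D) : P (P x) = P x := P_eq_self rfl

theorem inner_P_left (x y : X D) : inner ℝ (P x) y = inner ℝ x (P y) := by
  simp only [inner_X, fst_P, snd_P, avg, inner_smul_left, inner_smul_right, inner_add_left,
    inner_add_right, RCLike.conj_to_real]
  ring

/-- The diagonal is orthogonal to the kernel of `P`. -/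
theorem inner_eq_zero_of_P {x y : X D} (hx : P x = x) (hy : P y = 0) : inner ℝ x y = 0 := by
  rw [← hx, inner_P_left, hy, inner_zero_right]

theorem P_U (x : X D) : P (U x) = 0 := by
  rw [U, P_sub, P_P, sub_self]

theorem P_add_U (x : X D) : P x + U x = x := by
  rw [U]
  abel

theorem U_eq_self {x : X D} (h : P x = 0) : U x = x := by
  rw [U, h, sub_zero]

theorem U_sub (x y : X D) : U (x - y) = U x - U y := by
  rw [U, U, U, P_sub]
  abel

theorem continuous_avg : Continuous (avg : X D → E D) := by
  unfold avg
  fun_prop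

theorem continuous_P : Continuous (P : X D → X D) := by
  have := continuous_avg (D := D)
  unfold P pair
  fun_prop

theorem continuous_U : Continuous (U : X D → X D) := by
  have := continuous_P (D := D)
  unfold U
  fun_prop

end Projection

/-! ### The dual variable and the energy identity -/

section Energy

variable {D : ℕ}

/-- The relaxed projection `α P + (1 - α) Id`. -/
noncomputable def relaxedP (p : Input D) (x : X D) : X D := p.α • P x + (1 - p.α) • x

/-- The squared distance of the primal-dual pair `(x, w)` to `(x_*, U v_*)`, in the norm adapted
to the algorithm. -/
noncomputable def energy (p : Input D) (y : X D × X D) (x w : X D) : ℝ :=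
  ‖P x - y.1‖ ^ 2 + (1 - p.α) * ‖U x‖ ^ 2 + ‖w - U y.2‖ ^ 2 / (1 - p.α)

/-- The decrease of the energy in the step from `x` to `x'`. -/
noncomputable def dissipation (p : Input D) (x x' : X D) : ℝ :=
  ‖P x - P x'‖ ^ 2 + (1 - p.α) * ‖U x - U x'‖ ^ 2 + (2 * (2 * p.α - 1) + (1 - p.α)) * ‖U x'‖ ^ 2

theorem one_sub_α_pos (p : Input D) : 0 < 1 - p.α := by
  linarith [p.α_lt_one]

theorem energy_nonneg (p : Input D) (y : X D × X D) (x w : X D) : 0 ≤ energy p y x w := by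
  have := one_sub_α_pos p
  unfold energy
  positivity

theorem dissipation_nonneg (p : Input D) (x x' : X D) : 0 ≤ dissipation p x x' := by
  have := one_sub_α_pos p
  have : 0 ≤ 2 * p.α - 1 := by linarith [p.half_le_α]
  unfold dissipation
  positivity

/-- The inner product splits into a diagonal and an antidiagonal part. The diagonal part is a
three-point identity for `P x`, `P x'`, `x_*`. In the antidiagonal part the cross term of `U x'` and
`w - U v_*` is absorbed by the dual square: the weight `1 / (1 - α)` cancels the step length `1 - α`
of `w`. The last coefficient of `dissipation` is `3 α - 1`, written so that `α ≥ 1/2` shows its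
sign. -/
theorem energy_step (p : Input D) {y : X D × X D} (hy : P y.1 = y.1) (x x' w : X D)
    (hw : P w = 0) :
    energy p y x' (w + (1 - p.α) • U x') = energy p y x w - dissipation p x x' +
      2 * p.lam * inner ℝ (y.1 - x')
        (p.lam⁻¹ • (relaxedP p x - w - x') - -(p.lam⁻¹ • U y.2)) := by
  have hα := (one_sub_α_pos p).ne'
  have hlam := p.lam_pos.ne'
  have hx := P_add_U x
  have hx' := P_add_U x'
  have e : p.lam⁻¹ • (relaxedP p x - w - x') - -(p.lam⁻¹ • U y.2)
      = p.lam⁻¹ • ((P x - P x') + (((1 - p.α) • U x - U x') - (w - U y.2))) := by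
    rw [relaxedP, ← hx, ← hx']
    simp only [P_add, P_P, U, P_sub, sub_self, add_zero]
    module
  have e' : y.1 - x' = (y.1 - P x') - U x' := by
    nth_rw 1 [← hx']
    abel
  have o₁ : inner ℝ (y.1 - P x') (((1 - p.α) • U x - U x') - (w - U y.2)) = 0 := by
    apply inner_eq_zero_of_P
    · rw [P_sub, hy, P_P]
    · simp only [P_sub, P_smul, P_U, hw, smul_zero, sub_self]
  have o₂ : inner ℝ (U x') (P x - P x') = 0 := by
    rw [real_inner_comm]
    apply inner_eq_zero_of_P
    · rw [P_sub, P_P, P_P]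
    · exact P_U x'
  rw [e, e', inner_smul_right, inner_add_right, inner_sub_left (y.1 - P x'), o₂,
    inner_sub_left (y.1 - P x') (U x') (_ - _), o₁]
  unfold energy dissipation
  have q₁ : ‖P x' - y.1‖ ^ 2 = ‖P x - y.1‖ ^ 2 - ‖P x - P x'‖ ^ 2
      + 2 * inner ℝ (y.1 - P x') (P x - P x') := by
    have : P x - y.1 = (P x - P x') - (y.1 - P x') := by abel
    rw [this, norm_sub_sq_real (P x - P x'), real_inner_comm (y.1 - P x'), norm_sub_rev (P x')]
    ring
  have q₂ : ‖w + (1 - p.α) • U x' - U y.2‖ ^ 2 = ‖w - U y.2‖ ^ 2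
      + 2 * (1 - p.α) * inner ℝ (U x') (w - U y.2) + (1 - p.α) ^ 2 * ‖U x'‖ ^ 2 := by
    have : w + (1 - p.α) • U x' - U y.2 = (w - U y.2) + (1 - p.α) • U x' := by abel
    rw [this, norm_add_sq_real, inner_smul_right, norm_smul, mul_pow, Real.norm_eq_abs, sq_abs,
      real_inner_comm]
    ring
  have q₃ : inner ℝ (U x') ((1 - p.α) • U x - U x' - (w - U y.2)) =
      (1 - p.α) * inner ℝ (U x) (U x') - ‖U x'‖ ^ 2 - inner ℝ (U x') (w - U y.2) := by
    rw [inner_sub_right (U x') (_ - _), inner_sub_right (U x'), inner_smul_right,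
      real_inner_self_eq_norm_sq, real_inner_comm]
  rw [q₁, q₂, q₃, norm_sub_sq_real (U x)]
  field_simp
  ring

variable {Ω : Type*} (p : Input D) (a : ℕ → Ω → E D) (b : ℕ → Ω → ℝ)

/-- The dual iterate `α P x_n + (1 - α) x_n - x_{n+1/2}`. -/
noncomputable def dualIterate (n : ℕ) (ω : Ω) : X D :=
  relaxedP p (splitIterate p a b n ω) - halfIterate p a b n ω

theorem splitIterate_succ (n : ℕ) (ω : Ω) : splitIterate p a b (n + 1) ω =
    pair (mulVec (1 + p.lam • Rn p a n ω)⁻¹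
        ((halfIterate p a b n ω).fst + p.lam • rn p a b n ω))
      (soft (p.lam * p.ρ) (halfIterate p a b n ω).snd) := rfl

theorem halfIterate_succ (n : ℕ) (ω : Ω) : halfIterate p a b (n + 1) ω =
    halfIterate p a b n ω - p.α • P (splitIterate p a b n ω)
      - (1 - p.α) • splitIterate p a b n ω + P (splitIterate p a b (n + 1) ω) := rfl

theorem halfIterate_eq (n : ℕ) (ω : Ω) : halfIterate p a b n ω =
    relaxedP p (splitIterate p a b n ω) - dualIterate p a b n ω := by
  rw [dualIterate, sub_sub_cancel]

theorem dualIterate_zero (ω : Ω) : dualIterate p a b 0 ω = 0 := sub_self _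

/-- The relaxed projections of `x_n` cancel, and `α P + (1 - α) Id - P = (1 - α) U` is what remains
at `x_{n+1}`. -/
theorem dualIterate_succ (n : ℕ) (ω : Ω) : dualIterate p a b (n + 1) ω =
    dualIterate p a b n ω + (1 - p.α) • U (splitIterate p a b (n + 1) ω) := by
  rw [dualIterate, halfIterate_succ, halfIterate_eq, relaxedP, relaxedP, U]
  module

theorem P_dualIterate (n : ℕ) (ω : Ω) : P (dualIterate p a b n ω) = 0 := by
  induction n with
  | zero => rw [dualIterate_zero, P_zero]
  | succ n ih => rw [dualIterate_succ, P_add, ih, P_smul, P_U, smul_zero, add_zero]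

theorem energy_succ {y : X D × X D} (hy : P y.1 = y.1) (n : ℕ) (ω : Ω) :
    energy p y (splitIterate p a b (n + 1) ω) (dualIterate p a b (n + 1) ω) =
      energy p y (splitIterate p a b n ω) (dualIterate p a b n ω)
        - dissipation p (splitIterate p a b n ω) (splitIterate p a b (n + 1) ω)
        + vartheta p a b y n ω := by
  rw [dualIterate_succ, energy_step p hy _ _ _ (P_dualIterate p a b n ω), vartheta,
    halfIterate_eq]

theorem energy_add_sum_dissipation {y : X D × X D} (hy : P y.1 = y.1) (n : ℕ) (ω : Ω) :
    energy p y (splitIterate p a b n ω) (dualIterate p a b n ω)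
        + ∑ k ∈ Finset.range n,
          dissipation p (splitIterate p a b k ω) (splitIterate p a b (k + 1) ω) =
      energy p y p.x0 0 + ∑ k ∈ Finset.range n, vartheta p a b y k ω := by
  induction n with
  | zero => simp [dualIterate_zero, splitIterate, run]
  | succ n ih =>
    rw [Finset.sum_range_succ, Finset.sum_range_succ, energy_succ p a b hy]
    linarith

end Energy

end CRegLS

/-! ### An almost supermartingale convergence theorem -/

/-- Partial sums of an adapted sequence of integrable random variables that are bounded below
converge almost surely if the positive parts of the conditional increments have an integrable
sum. -/
theorem ae_exists_tendsto_sum_of_condExp_dominated {Ω : Type*} {m0 : MeasurableSpace Ω}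
    {μ : Measure Ω} [IsFiniteMeasure μ] (ℱ : Filtration ℕ m0) (f : ℕ → Ω → ℝ)
    (hint : ∀ k, Integrable (f k) μ) (hmeas : ∀ k, StronglyMeasurable[ℱ (k + 1)] (f k))
    (C : ℝ) (hC : ∀ n ω, -C ≤ ∑ k ∈ Finset.range n, f k ω)
    (ψ : Ω → ℝ) (hψ : Integrable ψ μ) (hψ0 : ∀ ω, 0 ≤ ψ ω)
    (hdom : ∀ᵐ ω ∂μ, ∑' n, ENNReal.ofReal (max 0 ((μ[f n | ℱ n]) ω)) ≤ ENNReal.ofReal (ψ ω)) :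
    ∀ᵐ ω ∂μ, ∃ l, Tendsto (fun n => ∑ k ∈ Finset.range n, f k ω) atTop (𝓝 l) := by
  set c : ℕ → Ω → ℝ := fun k ω => max 0 ((μ[f k | ℱ k]) ω) with hc
  have c_nonneg : ∀ k ω, 0 ≤ c k ω := fun k ω => le_max_left _ _
  have c_int : ∀ k, Integrable (c k) μ := fun k => by
    have := (integrable_condExp (m := ℱ k) (μ := μ) (f := f k)).pos_part
    simpa only [hc, max_comm] using this
  have c_meas : ∀ k, StronglyMeasurable[ℱ k] (c k) := fun k => by
    have h : StronglyMeasurable[ℱ k] (μ[f k | ℱ k]) := stronglyMeasurable_condExp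
    exact (continuous_const.max continuous_id).comp_stronglyMeasurable h
  -- Subtracting `f` from its compensator gives nonnegative conditional increments, the negative
  -- part of `μ[f k | ℱ k]`.
  set G : ℕ → Ω → ℝ := fun n => ∑ k ∈ Finset.range n, (c k - f k) with hG
  have G_apply : ∀ n ω, G n ω = ∑ k ∈ Finset.range n, c k ω - ∑ k ∈ Finset.range n, f k ω := by
    intro n ω
    simp only [hG, Finset.sum_apply, Pi.sub_apply, Finset.sum_sub_distrib]
  have G_int : ∀ n, Integrable (G n) μ := fun n =>
    integrable_finsetSum' _ fun k _ => (c_int k).sub (hint k)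
  have hsub : Submartingale G ℱ μ := by
    refine submartingale_of_condExp_sub_nonneg_nat ?_ G_int ?_
    · intro n
      refine Finset.stronglyMeasurable_sum _ fun k hk => ?_
      have hk' : k + 1 ≤ n := Finset.mem_range.1 hk
      exact ((c_meas k).mono (ℱ.mono (by omega))).sub ((hmeas k).mono (ℱ.mono hk'))
    · intro n
      have e : G (n + 1) - G n = c n - f n := by
        simp only [hG, Finset.sum_range_succ, add_sub_cancel_left]
      rw [e]
      filter_upwards [condExp_sub (c_int n) (hint n) (ℱ n)] with ω hω
      rw [hω, condExp_of_stronglyMeasurable (ℱ.le n) (c_meas n) (c_int n)]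
      simp [hc]
  have sum_le : ∀ᵐ ω ∂μ, ∀ n, ∑ k ∈ Finset.range n, c k ω ≤ ψ ω := by
    filter_upwards [hdom] with ω hω n
    rw [← ENNReal.ofReal_le_ofReal_iff (hψ0 ω), ENNReal.ofReal_sum_of_nonneg fun k _ => c_nonneg k ω]
    exact (ENNReal.sum_le_tsum _).trans hω
  have G_int_nonneg : ∀ n, 0 ≤ ∫ ω, G n ω ∂μ := fun n => by
    have := hsub.setIntegral_le (Nat.zero_le n) MeasurableSet.univ
    simpa [hG] using this
  have hbound : ∀ n, ∫ ω, ‖G n ω‖ ∂μ ≤ ∫ ω, 2 * (|C| + ψ ω) ∂μ := by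
    intro n
    have hint' : Integrable (fun ω => 2 * (|C| + ψ ω)) μ :=
      ((integrable_const |C|).add hψ).const_mul 2
    -- Since `G ≤ ψ + C`, the identity `|G| = 2 G⁺ - G` gives `|G| ≤ 2 (|C| + ψ) - G`; the
    -- expectation of `G n` is at least that of `G 0 = 0`, so the bound is uniform in `n`.
    have hle : ∫ ω, ‖G n ω‖ ∂μ ≤ ∫ ω, (2 * (|C| + ψ ω) - G n ω) ∂μ := by
      refine integral_mono_ae (G_int n).norm (hint'.sub (G_int n)) ?_
      filter_upwards [sum_le] with ω hω
      have h₁ := hω n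
      have h₂ := hC n ω
      have h₃ := G_apply n ω
      have h₄ := le_abs_self C
      have h₅ := abs_nonneg C
      have h₆ := hψ0 ω
      rw [Real.norm_eq_abs]
      rcases abs_cases (G n ω) with h | h <;> linarith
    rw [integral_sub hint' (G_int n)] at hle
    linarith [G_int_nonneg n]
  have hL1 : ∀ n, eLpNorm (G n) 1 μ ≤ ((∫ ω, 2 * (|C| + ψ ω) ∂μ).toNNReal : NNReal) := by
    intro n
    rw [eLpNorm_one_eq_lintegral_enorm, ← ofReal_integral_norm_eq_lintegral_enorm (G_int n)]
    exact ENNReal.ofReal_le_ofReal (hbound n)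
  filter_upwards [hsub.ae_tendsto_limitProcess hL1, sum_le] with ω hω hle
  obtain ⟨s, hs⟩ : ∃ s, Tendsto (fun n => ∑ k ∈ Finset.range n, c k ω) atTop (𝓝 s) := by
    refine ⟨_, tendsto_atTop_ciSup (fun m n hmn => ?_) ⟨ψ ω, ?_⟩⟩
    · exact Finset.sum_le_sum_of_subset_of_nonneg (Finset.range_mono hmn) fun k _ _ => c_nonneg k ω
    · rintro _ ⟨n, rfl⟩
      exact hle n
  refine ⟨_, (hs.sub hω).congr fun n => ?_⟩
  rw [G_apply, sub_sub_cancel]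

namespace CRegLS

/-! ### The regularized least-squares problem -/

section Problem

variable {D : ℕ}

theorem inner_E (x y : E D) : inner ℝ x y = ∑ i, x i * y i := by
  simp [PiLp.inner_apply, mul_comm]

theorem mulVec_add (M : Matrix (Fin D) (Fin D) ℝ) (x y : E D) :
    mulVec M (x + y) = mulVec M x + mulVec M y := by
  simp [mulVec, Matrix.mulVec_add]

theorem mulVec_smul (M : Matrix (Fin D) (Fin D) ℝ) (c : ℝ) (x : E D) :
    mulVec M (c • x) = c • mulVec M x := by
  simp [mulVec, Matrix.mulVec_smul]

theorem continuous_mulVec :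
    Continuous fun q : Matrix (Fin D) (Fin D) ℝ × E D => mulVec q.1 q.2 := by
  unfold mulVec
  refine (PiLp.continuous_toLp 2 _).comp (Continuous.matrix_mulVec continuous_fst ?_)
  fun_prop

theorem continuous_l1 : Continuous (l1 : E D → ℝ) := by
  unfold l1
  fun_prop

theorem continuous_ensembleLoss (R : Matrix (Fin D) (Fin D) ℝ) (r : E D) (β : ℝ) :
    Continuous (ensembleLoss R r β) := by
  have h : Continuous (mulVec R) :=
    continuous_mulVec.comp (continuous_const.prodMk continuous_id)
  unfold ensembleLoss
  fun_prop

theorem l1_add_smul_le (x z : E D) {t : ℝ} (h0 : 0 ≤ t) (h1 : t ≤ 1) :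
    l1 (x + t • (z - x)) ≤ (1 - t) * l1 x + t * l1 z := by
  unfold l1
  rw [Finset.mul_sum, Finset.mul_sum, ← Finset.sum_add_distrib]
  refine Finset.sum_le_sum fun d _ => ?_
  have e : (x + t • (z - x)) d = (1 - t) * x d + t * z d := by
    simp
    ring
  rw [e]
  refine (abs_add_le _ _).trans_eq ?_
  rw [abs_mul, abs_mul, abs_of_nonneg h0, abs_of_nonneg (sub_nonneg.2 h1)]

theorem norm_le_l1 (x : E D) : ‖x‖ ≤ l1 x := by
  have h : 0 ≤ l1 x := Finset.sum_nonneg fun d _ => abs_nonneg (x d)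
  rw [EuclideanSpace.norm_eq, Real.sqrt_le_left h]
  exact Finset.sum_sq_le_sq_sum_of_nonneg fun d _ => abs_nonneg (x d)

theorem ensembleLoss_add {R : Matrix (Fin D) (Fin D) ℝ}
    (hsymm : ∀ x y : E D, inner ℝ x (mulVec R y) = inner ℝ y (mulVec R x)) (r : E D) (β : ℝ)
    (x d : E D) : ensembleLoss R r β (x + d) =
      ensembleLoss R r β x + inner ℝ (mulVec R x - r) d + 1 / 2 * inner ℝ d (mulVec R d) := by
  unfold ensembleLoss
  rw [mulVec_add, inner_add_left, inner_add_right, inner_add_right, inner_add_right,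
    inner_sub_left, hsymm x d, real_inner_comm d (mulVec R x)]
  ring

theorem mem_subdifferential_splitObjective {R : Matrix (Fin D) (Fin D) ℝ}
    (hsymm : ∀ x y : E D, inner ℝ x (mulVec R y) = inner ℝ y (mulVec R x))
    (hnonneg : ∀ x : E D, 0 ≤ inner ℝ x (mulVec R x)) (r : E D) (β ρ : ℝ) {x ξ : X D}
    (h₁ : ξ.fst = mulVec R x.fst - r)
    (h₂ : ∀ z, ρ * l1 x.snd + inner ℝ ξ.snd (z - x.snd) ≤ ρ * l1 z) :
    ξ ∈ subdifferential (splitObjective R r β ρ) x := by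
  intro z
  have h := ensembleLoss_add hsymm r β x.fst (z.fst - x.fst)
  rw [add_sub_cancel] at h
  have h' := hnonneg (z.fst - x.fst)
  have h'' := h₂ z.snd
  rw [inner_X, h₁]
  simp only [splitObjective, WithLp.sub_fst, WithLp.sub_snd]
  linarith

/-- A point of the diagonal with a subgradient orthogonal to the diagonal is a solution. -/
theorem isSolution_of_mem_Upsilon (p : Input D) {R : Matrix (Fin D) (Fin D) ℝ} {r : E D} {β : ℝ}
    {y : X D × X D} (hy : y ∈ Upsilon p R r β) : IsSolution R r β p.ρ y.1.fst := by
  intro z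
  have h := hy.2 (pair z z)
  have o : inner ℝ (-(p.lam⁻¹ • U y.2)) (pair z z - y.1) = 0 := by
    rw [real_inner_comm]
    apply inner_eq_zero_of_P
    · rw [P_sub, P_eq_self hy.1, P_eq_self rfl]
    · rw [← neg_smul, P_smul, P_U, smul_zero]
  rw [o, add_zero] at h
  simp only [splitObjective, ← hy.1] at h
  exact h

/-- The loss is nonnegative, so the `ℓ₁` term alone makes the objective coercive, even when `R` is
singular. -/
theorem exists_isSolution {R : Matrix (Fin D) (Fin D) ℝ} {r : E D} {β ρ : ℝ} (hρ : 0 < ρ)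
    (hloss : ∀ x, 0 ≤ ensembleLoss R r β x) : ∃ x, IsSolution R r β ρ x := by
  have hcont : Continuous fun x => ensembleLoss R r β x + ρ * l1 x :=
    (continuous_ensembleLoss R r β).add (continuous_const.mul continuous_l1)
  refine hcont.exists_forall_le ?_
  refine tendsto_atTop_mono (f := fun x : E D => ρ * ‖x‖) (fun x => ?_)
    ((tendsto_norm_cocompact_atTop (E := E D)).const_mul_atTop hρ)
  have := mul_le_mul_of_nonneg_left (norm_le_l1 x) hρ.le
  linarith [hloss x]

/-- First-order optimality condition. -/
theorem IsSolution.l1_subgradient {R : Matrix (Fin D) (Fin D) ℝ}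
    (hsymm : ∀ x y : E D, inner ℝ x (mulVec R y) = inner ℝ y (mulVec R x))
    (hnonneg : ∀ x : E D, 0 ≤ inner ℝ x (mulVec R x)) {r : E D} {β ρ : ℝ} (hρ : 0 < ρ) {x : E D}
    (hx : IsSolution R r β ρ x) (z : E D) :
    ρ * l1 x + inner ℝ (-(mulVec R x - r)) (z - x) ≤ ρ * l1 z := by
  set A := ρ * l1 z - ρ * l1 x + inner ℝ (mulVec R x - r) (z - x) with hA
  set q := inner ℝ (z - x) (mulVec R (z - x)) with hq
  have hq0 : 0 ≤ q := hnonneg _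
  have key : ∀ t : ℝ, 0 < t → t ≤ 1 → 0 ≤ A + t * q / 2 := by
    intro t h0 h1
    have h := hx (x + t • (z - x))
    rw [ensembleLoss_add hsymm, inner_smul_right, mulVec_smul, inner_smul_left, inner_smul_right,
      RCLike.conj_to_real] at h
    have h' := mul_le_mul_of_nonneg_left (l1_add_smul_le x z h0.le h1) hρ.le
    refine nonneg_of_mul_nonneg_right (?_ : 0 ≤ t * (A + t * q / 2)) h0
    rw [hA]
    linarith
  have hA0 : 0 ≤ A := by
    by_contra! hneg
    -- This `t` satisfies `t (q + 1) ≤ -A`, which contradicts `A + t q / 2 ≥ 0`; the summand `1`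
    -- covers `q = 0`.
    have ht : 0 < min 1 (-A / (q + 1)) := lt_min one_pos (div_pos (by linarith) (by linarith))
    have h := key _ ht (min_le_left _ _)
    have h' : min 1 (-A / (q + 1)) * (q + 1) ≤ -A := by
      calc _ ≤ -A / (q + 1) * (q + 1) :=
            mul_le_mul_of_nonneg_right (min_le_right _ _) (by linarith)
        _ = -A := div_mul_cancel₀ _ (by linarith)
    linarith
  rw [inner_neg_left]
  linarith

theorem Upsilon_nonempty (p : Input D) {R : Matrix (Fin D) (Fin D) ℝ}
    (hsymm : ∀ x y : E D, inner ℝ x (mulVec R y) = inner ℝ y (mulVec R x))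
    (hnonneg : ∀ x : E D, 0 ≤ inner ℝ x (mulVec R x)) {r : E D} {β : ℝ}
    (hloss : ∀ x, 0 ≤ ensembleLoss R r β x) : (Upsilon p R r β).Nonempty := by
  obtain ⟨x, hx⟩ := exists_isSolution p.ρ_pos hloss
  set ζ := mulVec R x - r with hζ
  -- At a solution `-ζ` is a subgradient of `ρ ‖·‖₁`, so `(ζ, -ζ)` is a subgradient of the split
  -- objective. It is antidiagonal, hence fixed by `U`, and `v` only has to undo the factor `-1/λ`.
  set v : X D := (-p.lam) • pair ζ (-ζ) with hv
  have hPv : P v = 0 := by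
    have h : avg (pair ζ (-ζ)) = 0 := by simp [avg, pair]
    rw [hv, P_smul, P, h]
    exact smul_zero _
  have e : -(p.lam⁻¹ • U v) = pair ζ (-ζ) := by
    rw [U_eq_self hPv, hv, smul_smul, ← neg_smul, mul_neg, neg_neg, inv_mul_cancel₀ p.lam_pos.ne',
      one_smul]
  refine ⟨(pair x x, v), rfl, ?_⟩
  rw [e]
  exact mem_subdifferential_splitObjective hsymm hnonneg r β p.ρ rfl
    (hx.l1_subgradient hsymm hnonneg p.ρ_pos)

end Problem

/-! ### Soft-thresholding -/

section Soft

variable {D : ℕ}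

theorem continuous_soft {τ : ℝ} (hτ : 0 < τ) : Continuous (soft τ : E D → E D) := by
  unfold soft
  refine (PiLp.continuous_toLp 2 _).comp (continuous_pi fun d => ?_)
  have h : ∀ u : E D, max τ |u d| ≠ 0 := fun u => (lt_max_of_lt_left hτ).ne'
  fun_prop (disch := exact h _)

theorem norm_soft_le {τ : ℝ} (hτ : 0 < τ) (u : E D) : ‖soft τ u‖ ≤ ‖u‖ := by
  rw [EuclideanSpace.norm_eq, EuclideanSpace.norm_eq]
  refine Real.sqrt_le_sqrt (Finset.sum_le_sum fun d _ => ?_)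
  have hm : 0 < max τ |u d| := lt_max_of_lt_left hτ
  have h₁ : τ / max τ |u d| ≤ 1 := (div_le_one hm).2 (le_max_left _ _)
  have h₀ : 0 ≤ τ / max τ |u d| := by positivity
  have e : soft τ u d = u d * (1 - τ / max τ |u d|) := rfl
  rw [e, norm_mul]
  gcongr
  refine mul_le_of_le_one_right (norm_nonneg _) ?_
  rw [Real.norm_eq_abs, abs_le]
  constructor <;> linarith

/-- Soft-thresholding is the proximal map of the scaled `ℓ₁`-norm. -/
theorem soft_subgradient {τ : ℝ} (hτ : 0 < τ) (u z : E D) :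
    τ * l1 (soft τ u) + inner ℝ (u - soft τ u) (z - soft τ u) ≤ τ * l1 z := by
  rw [inner_E, l1, l1, Finset.mul_sum, Finset.mul_sum, ← Finset.sum_add_distrib]
  refine Finset.sum_le_sum fun d _ => ?_
  have e : soft τ u d = u d * (1 - τ / max τ |u d|) := rfl
  have hz₁ := le_abs_self (z d)
  have hz₂ := neg_abs_le (z d)
  simp only [PiLp.sub_apply]
  -- Either the coordinate is set to zero and the residual `u d` has size at most `τ`, or it shrinks
  -- by `τ` and the residual is `τ` times its sign.
  rcases le_or_gt |u d| τ with h | h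
  · have e' : soft τ u d = 0 := by rw [e, max_eq_left h, div_self hτ.ne', sub_self, mul_zero]
    rw [e', abs_zero, mul_zero, zero_add, sub_zero, sub_zero]
    calc u d * z d ≤ |u d * z d| := le_abs_self _
      _ = |u d| * |z d| := abs_mul _ _
      _ ≤ τ * |z d| := mul_le_mul_of_nonneg_right h (abs_nonneg _)
  · rw [max_eq_right h.le] at e
    rcases lt_abs.1 h with h' | h'
    · have e' : soft τ u d = u d - τ := by
        rw [e, abs_of_pos (hτ.trans h'), mul_sub, mul_div_cancel₀ _ (hτ.trans h').ne', mul_one]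
      rw [e', abs_of_pos (sub_pos.2 h')]
      nlinarith
    · have hu : u d < 0 := by linarith
      have e' : soft τ u d = u d + τ := by
        rw [e, abs_of_neg hu, div_neg, sub_neg_eq_add, mul_add, mul_div_cancel₀ _ hu.ne, mul_one]
      rw [e', abs_of_neg (by linarith : u d + τ < 0)]
      nlinarith

end Soft

end CRegLS

namespace CRegLS

/-! ### Moments of the regression model -/

section Moments

variable {Ω : Type*} [MeasurableSpace Ω] {μ : Measure Ω} {D : ℕ} {θ : E D}
  {a : ℕ → Ω → E D} {b η : ℕ → Ω → ℝ} {R : Matrix (Fin D) (Fin D) ℝ} {r : E D} {β : ℝ}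

theorem RegressionModel.memLp_inner (h : RegressionModel μ θ a b η R r β) (x : E D) :
    MemLp (fun ω => inner ℝ (a 1 ω) x) 2 μ :=
  (h.memLp_a 1 le_rfl).inner_const x

theorem RegressionModel.memLp_coord (h : RegressionModel μ θ a b η R r β) (i : Fin D) :
    MemLp (fun ω => a 1 ω i) 2 μ := by
  refine (h.memLp_inner (EuclideanSpace.single i 1)).ae_eq (.of_forall fun ω => ?_)
  simp [EuclideanSpace.inner_single_right]

/-- As a second moment, the quadratic form of `R` is visibly symmetric and nonnegative. -/
theorem RegressionModel.inner_mulVec (h : RegressionModel μ θ a b η R r β) (x y : E D) :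
    inner ℝ x (mulVec R y) = ∫ ω, inner ℝ (a 1 ω) x * inner ℝ (a 1 ω) y ∂μ := by
  have hint : ∀ i j, Integrable (fun ω => x i * y j * (a 1 ω i * a 1 ω j)) μ := fun i j =>
    ((h.memLp_coord i).integrable_mul (h.memLp_coord j)).const_mul _
  have e : ∀ ω, inner ℝ (a 1 ω) x * inner ℝ (a 1 ω) y =
      ∑ i, ∑ j, x i * y j * (a 1 ω i * a 1 ω j) := by
    intro ω
    rw [inner_E, inner_E, Finset.sum_mul_sum]
    exact Finset.sum_congr rfl fun i _ => Finset.sum_congr rfl fun j _ => by ring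
  simp_rw [e]
  rw [integral_finsetSum _ fun i _ => integrable_finsetSum _ fun j _ => hint i j, inner_E]
  refine Finset.sum_congr rfl fun i _ => ?_
  rw [integral_finsetSum _ fun j _ => hint i j]
  change x i * ∑ j, R i j * y j = _
  rw [Finset.mul_sum]
  refine Finset.sum_congr rfl fun j _ => ?_
  rw [integral_const_mul, h.moment_R 1 le_rfl]
  ring

theorem RegressionModel.inner_r (h : RegressionModel μ θ a b η R r β) (x : E D) :
    inner ℝ r x = ∫ ω, b 1 ω * inner ℝ (a 1 ω) x ∂μ := by
  have hint : ∀ i, Integrable (fun ω => b 1 ω * a 1 ω i * x i) μ := fun i =>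
    ((h.memLp_b 1 le_rfl).integrable_mul (h.memLp_coord i)).mul_const _
  have e : ∀ ω, b 1 ω * inner ℝ (a 1 ω) x = ∑ i, b 1 ω * a 1 ω i * x i := by
    intro ω
    rw [inner_E, Finset.mul_sum]
    exact Finset.sum_congr rfl fun i _ => by ring
  simp_rw [e]
  rw [integral_finsetSum _ fun i _ => hint i, inner_E]
  refine Finset.sum_congr rfl fun i _ => ?_
  rw [integral_mul_const, h.moment_r 1 le_rfl]

theorem RegressionModel.inner_mulVec_comm (h : RegressionModel μ θ a b η R r β) (x y : E D) :
    inner ℝ x (mulVec R y) = inner ℝ y (mulVec R x) := by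
  simp_rw [h.inner_mulVec, mul_comm]

theorem RegressionModel.inner_mulVec_self_nonneg (h : RegressionModel μ θ a b η R r β)
    (x : E D) : 0 ≤ inner ℝ x (mulVec R x) := by
  rw [h.inner_mulVec]
  exact integral_nonneg fun ω => mul_self_nonneg _

/-- The loss is half the expectation of `(a_1ᵀ x - b_1)²`. -/
theorem RegressionModel.ensembleLoss_nonneg (h : RegressionModel μ θ a b η R r β) (x : E D) :
    0 ≤ ensembleLoss R r β x := by
  have i₁ : Integrable (fun ω => inner ℝ (a 1 ω) x * inner ℝ (a 1 ω) x) μ :=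
    (h.memLp_inner x).integrable_mul (h.memLp_inner x)
  have i₂ : Integrable (fun ω => b 1 ω * inner ℝ (a 1 ω) x) μ :=
    (h.memLp_b 1 le_rfl).integrable_mul (h.memLp_inner x)
  have i₃ : Integrable (fun ω => b 1 ω ^ 2) μ := (h.memLp_b 1 le_rfl).integrable_sq
  have i₄ : Integrable (fun ω => 1 / 2 * (inner ℝ (a 1 ω) x * inner ℝ (a 1 ω) x)
      - b 1 ω * inner ℝ (a 1 ω) x) μ := (i₁.const_mul _).sub i₂
  have e : ensembleLoss R r β x = ∫ ω, (1 / 2 * (inner ℝ (a 1 ω) x * inner ℝ (a 1 ω) x)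
      - b 1 ω * inner ℝ (a 1 ω) x + 1 / 2 * b 1 ω ^ 2) ∂μ := by
    rw [integral_add i₄ (i₃.const_mul _), integral_sub (i₁.const_mul _) i₂,
      integral_const_mul, integral_const_mul, ensembleLoss, h.inner_mulVec, h.inner_r,
      h.moment_b 1 le_rfl]
  rw [e]
  refine integral_nonneg fun ω => ?_
  have := sq_nonneg (inner ℝ (a 1 ω) x - b 1 ω)
  change 0 ≤ _
  linarith

end Moments

/-! ### The empirical step -/

section EmpiricalStep

variable {Ω : Type*} {D : ℕ} (p : Input D) (a : ℕ → Ω → E D) (b : ℕ → Ω → ℝ)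

theorem posSemidef_Rn {n : ℕ} (hn : n ≠ 0) (ω : Ω) : (Rn p a n ω).PosSemidef := by
  rw [Rn, if_neg hn]
  refine Matrix.PosSemidef.smul ?_ (by positivity)
  refine Matrix.posSemidef_sum _ fun ν _ => ?_
  simpa using Matrix.posSemidef_vecMulVec_self_star (a ν ω).ofLp

theorem mulVec_inv_cancel {n : ℕ} (hn : n ≠ 0) (ω : Ω) (x : E D) :
    mulVec (1 + p.lam • Rn p a n ω)⁻¹ x
      + p.lam • mulVec (Rn p a n ω) (mulVec (1 + p.lam • Rn p a n ω)⁻¹ x) = x := by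
  have hpos : (1 + p.lam • Rn p a n ω).PosDef :=
    Matrix.PosDef.one.add_posSemidef ((posSemidef_Rn p a hn ω).smul p.lam_pos.le)
  have hdet : IsUnit (1 + p.lam • Rn p a n ω).det :=
    (Matrix.isUnit_iff_isUnit_det _).1 hpos.isUnit
  set M := (1 + p.lam • Rn p a n ω)⁻¹ with hM
  have e : mulVec (1 + p.lam • Rn p a n ω) (mulVec M x) = x := by
    simp [mulVec, Matrix.mulVec_mulVec, hM, Matrix.mul_nonsing_inv _ hdet]
  have e' : ∀ z, mulVec (1 + p.lam • Rn p a n ω) z = z + p.lam • mulVec (Rn p a n ω) z := fun z => by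
    simp [mulVec, Matrix.add_mulVec, Matrix.smul_mulVec]
  rw [← e', e]

theorem inner_mulVec_Rn {n : ℕ} (hn : n ≠ 0) (ω : Ω) (x : E D) :
    inner ℝ x (mulVec (Rn p a n ω) x) =
      (1 / (n : ℝ)) * ∑ ν ∈ Finset.Icc 1 n, inner ℝ (a ν ω) x ^ 2 := by
  have e : mulVec (Rn p a n ω) x =
      (1 / (n : ℝ)) • ∑ ν ∈ Finset.Icc 1 n, inner ℝ (a ν ω) x • a ν ω := by
    ext i
    simp only [mulVec, Rn, if_neg hn, Matrix.smul_mulVec, Matrix.sum_mulVec, Matrix.vecMulVec_mulVec,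
      PiLp.smul_apply, WithLp.ofLp_sum, Pi.smul_apply, Finset.sum_apply, WithLp.ofLp_smul,
      inner_E, dotProduct]
    simp [mul_comm]
  rw [e, inner_smul_right, inner_sum]
  congr 1
  refine Finset.sum_congr rfl fun ν _ => ?_
  rw [inner_smul_right, real_inner_comm, sq]

theorem inner_rn {n : ℕ} (hn : n ≠ 0) (ω : Ω) (x : E D) :
    inner ℝ (rn p a b n ω) x =
      (1 / (n : ℝ)) * ∑ ν ∈ Finset.Icc 1 n, b ν ω * inner ℝ (a ν ω) x := by
  rw [rn, if_neg hn, real_inner_smul_left, sum_inner]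
  simp_rw [real_inner_smul_left]

/-- Pair the normal equation `u + λ R_n u = q + λ r_n` with `u`. By Young's inequality the products
`b_ν (a_νᵀ u)` from `r_n` are absorbed by the squares `(a_νᵀ u)²` from `R_n`. Only `∑ b_ν²`
survives, so the iterates are square-integrable without fourth moments of the data. -/
theorem norm_sq_step_le {n : ℕ} (hn : n ≠ 0) (ω : Ω) (q : E D) :
    ‖mulVec (1 + p.lam • Rn p a n ω)⁻¹ (q + p.lam • rn p a b n ω)‖ ^ 2 ≤
      ‖q‖ ^ 2 + p.lam / (2 * n) * ∑ ν ∈ Finset.Icc 1 n, b ν ω ^ 2 := by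
  have h := mulVec_inv_cancel p a hn ω (q + p.lam • rn p a b n ω)
  set u := mulVec (1 + p.lam • Rn p a n ω)⁻¹ (q + p.lam • rn p a b n ω) with hu
  have h' := congrArg (fun z => inner ℝ z u) h
  simp only [inner_add_left, real_inner_smul_left, real_inner_self_eq_norm_sq] at h'
  rw [real_inner_comm, inner_mulVec_Rn p a hn, inner_rn p a b hn] at h'
  have hn' : (0 : ℝ) < n := by positivity
  have hs : ∑ ν ∈ Finset.Icc 1 n, b ν ω * inner ℝ (a ν ω) u ≤
      ∑ ν ∈ Finset.Icc 1 n, inner ℝ (a ν ω) u ^ 2 + 1 / 4 * ∑ ν ∈ Finset.Icc 1 n, b ν ω ^ 2 := by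
    rw [Finset.mul_sum, ← Finset.sum_add_distrib]
    refine Finset.sum_le_sum fun ν _ => ?_
    nlinarith [sq_nonneg (inner ℝ (a ν ω) u - 1 / 2 * b ν ω)]
  have hs' := mul_le_mul_of_nonneg_left hs (mul_pos p.lam_pos (one_div_pos.2 hn')).le
  have hq : inner ℝ q u ≤ 1 / 2 * ‖q‖ ^ 2 + 1 / 2 * ‖u‖ ^ 2 := by
    nlinarith [real_inner_le_norm q u, sq_nonneg (‖q‖ - ‖u‖)]
  have e : p.lam / (2 * n) * ∑ ν ∈ Finset.Icc 1 n, b ν ω ^ 2 =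
      2 * (p.lam * (1 / n) * (1 / 4 * ∑ ν ∈ Finset.Icc 1 n, b ν ω ^ 2)) := by
    field_simp
    ring
  rw [e]
  rw [mul_add] at hs'
  linarith

end EmpiricalStep

/-! ### Measurability and integrability of the iterates -/

section Measurability

variable {Ω : Type*} {D : ℕ} (p : Input D) {a : ℕ → Ω → E D} {b : ℕ → Ω → ℝ}

theorem measurable_iterates_zero [MeasurableSpace Ω] :
    Measurable (splitIterate p a b 0) ∧ Measurable (halfIterate p a b 0) :=
  ⟨measurable_const, measurable_const⟩

theorem measurable_mulVec_inv [MeasurableSpace Ω] {M : Ω → Matrix (Fin D) (Fin D) ℝ}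
    {x : Ω → E D} (hM : ∀ i j, Measurable fun ω => M ω i j) (hx : Measurable x) :
    Measurable fun ω => mulVec (M ω)⁻¹ (x ω) := by
  have hM' : Measurable (fun ω i j => M ω i j : Ω → Fin D → Fin D → ℝ) :=
    measurable_pi_iff.2 fun i => measurable_pi_iff.2 fun j => hM i j
  have hdet : Measurable fun ω => (M ω).det := by
    have hc : Continuous fun N : Fin D → Fin D → ℝ => (Matrix.of N).det :=
      Continuous.matrix_det continuous_id
    exact hc.measurable.comp hM'
  have hadj : ∀ i j, Measurable fun ω => (M ω).adjugate i j := by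
    intro i j
    have hc : Continuous fun N : Fin D → Fin D → ℝ => (Matrix.of N).adjugate :=
      Continuous.matrix_adjugate continuous_id
    exact (hc.matrix_elem i j).measurable.comp hM'
  refine (WithLp.measurable_toLp 2 _).comp (measurable_pi_iff.2 fun i => ?_)
  simp only [Matrix.mulVec, dotProduct]
  refine Finset.measurable_fun_sum _ fun j _ => Measurable.mul ?_ ?_
  -- The formula `det⁻¹ • adjugate` also describes the default value at singular matrices, so
  -- invertibility is not needed.
  · simp only [Matrix.inv_def, Ring.inverse_eq_inv', Matrix.smul_apply, smul_eq_mul]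
    exact hdet.inv.mul (hadj i j)
  · exact (EuclideanSpace.proj j : E D →L[ℝ] ℝ).measurable.comp hx

theorem measurable_Rn [MeasurableSpace Ω] (ha : ∀ n, 1 ≤ n → Measurable (a n)) (n : ℕ)
    (i j : Fin D) : Measurable fun ω => Rn p a n ω i j := by
  by_cases hn : n = 0
  · simp only [Rn, if_pos hn]
    exact measurable_const
  · simp only [Rn, if_neg hn, Matrix.smul_apply, Matrix.sum_apply, Matrix.vecMulVec_apply]
    refine Measurable.fun_const_smul ?_ _
    refine Finset.measurable_fun_sum _ fun ν hν => ?_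
    have hc : ∀ i, Measurable fun ω => a ν ω i := fun i =>
      (EuclideanSpace.proj i : E D →L[ℝ] ℝ).measurable.comp (ha ν (Finset.mem_Icc.1 hν).1)
    exact (hc i).mul (hc j)

theorem measurable_rn [MeasurableSpace Ω] (ha : ∀ n, 1 ≤ n → Measurable (a n))
    (hb : ∀ n, 1 ≤ n → Measurable (b n)) (n : ℕ) : Measurable (rn p a b n) := by
  by_cases hn : n = 0
  · have e : rn p a b n = fun _ => p.r0 := funext fun ω => by rw [rn, if_pos hn]
    rw [e]
    exact measurable_const
  · have e : rn p a b n = fun ω => (1 / (n : ℝ)) • ∑ ν ∈ Finset.Icc 1 n, b ν ω • a ν ω :=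
      funext fun ω => by rw [rn, if_neg hn]
    rw [e]
    refine Measurable.fun_const_smul ?_ _
    refine Finset.measurable_fun_sum _ fun ν hν => ?_
    have h := (Finset.mem_Icc.1 hν).1
    exact (hb ν h).smul (ha ν h)

theorem measurable_fst_X : Measurable fun x : X D => x.fst :=
  Continuous.measurable (by fun_prop)

theorem measurable_snd_X : Measurable fun x : X D => x.snd :=
  Continuous.measurable (by fun_prop)

theorem measurable_pair [MeasurableSpace Ω] {u w : Ω → E D} (hu : Measurable u)
    (hw : Measurable w) : Measurable fun ω => pair (u ω) (w ω) := by
  have hc : Continuous fun q : E D × E D => pair q.1 q.2 := by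
    unfold pair
    fun_prop
  exact hc.measurable.comp (hu.prodMk hw)

theorem measurable_halfIterate_succ [MeasurableSpace Ω] {n : ℕ}
    (hx : Measurable (splitIterate p a b n)) (hh : Measurable (halfIterate p a b n))
    (hx' : Measurable (splitIterate p a b (n + 1))) : Measurable (halfIterate p a b (n + 1)) := by
  have e : halfIterate p a b (n + 1) = fun ω => _ := funext fun ω => halfIterate_succ p a b n ω
  rw [e]
  have hP := (continuous_P (D := D)).measurable
  exact ((hh.sub ((hP.comp hx).const_smul p.α)).sub (hx.const_smul (1 - p.α))).add (hP.comp hx')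

theorem measurable_iterates [MeasurableSpace Ω] (ha : ∀ n, 1 ≤ n → Measurable (a n))
    (hb : ∀ n, 1 ≤ n → Measurable (b n)) (n : ℕ) :
    Measurable (splitIterate p a b n) ∧ Measurable (halfIterate p a b n) := by
  induction n with
  | zero => exact measurable_iterates_zero p
  | succ n ih =>
    have hx' : Measurable (splitIterate p a b (n + 1)) := by
      have e : splitIterate p a b (n + 1) = fun ω => _ :=
        funext fun ω => splitIterate_succ p a b n ω
      rw [e]
      refine measurable_pair (measurable_mulVec_inv (fun i j => ?_) ?_) ?_
      · simp only [Matrix.add_apply, Matrix.smul_apply]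
        exact ((measurable_Rn p ha n i j).const_smul p.lam).const_add _
      · exact (measurable_fst_X.comp ih.2).add ((measurable_rn p ha hb n).const_smul p.lam)
      · exact (continuous_soft (mul_pos p.lam_pos p.ρ_pos)).measurable.comp
          (measurable_snd_X.comp ih.2)
    exact ⟨hx', measurable_halfIterate_succ p ih.1 ih.2 hx'⟩

/-- The filtration generated by the split iterates. -/
noncomputable def iterateFiltration [m0 : MeasurableSpace Ω] (ha : ∀ n, 1 ≤ n → Measurable (a n))
    (hb : ∀ n, 1 ≤ n → Measurable (b n)) : Filtration ℕ m0 where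
  seq := pastSigma p a b
  mono' _ _ h := biSup_mono fun _ hν => le_trans hν h
  le' _ := iSup₂_le fun ν _ => (measurable_iterates p ha hb ν).1.comap_le

theorem measurable_splitIterate_pastSigma {n m : ℕ} (h : n ≤ m) :
    Measurable[pastSigma p a b m] (splitIterate p a b n) := by
  rw [measurable_iff_comap_le]
  exact le_biSup (fun ν => MeasurableSpace.comap (splitIterate p a b ν) inferInstance)
    (Set.mem_Iic.2 h)

/-- The recursion for the half iterates involves the data only through the split iterates, and the
initial one is constant. -/
theorem measurable_halfIterate_pastSigma {n m : ℕ} (h : n ≤ m) :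
    Measurable[pastSigma p a b m] (halfIterate p a b n) := by
  induction n with
  | zero => exact @measurable_const _ _ _ (pastSigma p a b m) _
  | succ n ih =>
    exact @measurable_halfIterate_succ _ _ p a b (pastSigma p a b m) n
      (measurable_splitIterate_pastSigma p (by omega)) (ih (by omega))
      (measurable_splitIterate_pastSigma p h)

theorem stronglyMeasurable_vartheta (y : X D × X D) (n : ℕ) :
    StronglyMeasurable[pastSigma p a b (n + 1)] (vartheta p a b y n) := by
  have hx := measurable_splitIterate_pastSigma (a := a) (b := b) p (le_refl (n + 1))
  have hh := measurable_halfIterate_pastSigma (a := a) (b := b) p (Nat.le_succ n)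
  have hc : Continuous fun q : X D × X D => 2 * p.lam * inner ℝ (y.1 - q.1)
      (p.lam⁻¹ • (q.2 - q.1) - -(p.lam⁻¹ • U y.2)) := by fun_prop
  exact (hc.measurable.comp (hx.prodMk hh)).stronglyMeasurable

theorem memLp_iterates [MeasurableSpace Ω] {μ : Measure Ω} [IsProbabilityMeasure μ]
    (ha : ∀ n, 1 ≤ n → Measurable (a n)) (hb : ∀ n, 1 ≤ n → Measurable (b n))
    (hb' : ∀ n, 1 ≤ n → MemLp (b n) 2 μ) (n : ℕ) :
    MemLp (splitIterate p a b n) 2 μ ∧ MemLp (halfIterate p a b n) 2 μ := by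
  have hPL : ∀ {f : Ω → X D}, Measurable f → MemLp f 2 μ → MemLp (fun ω => P (f ω)) 2 μ := by
    intro f hf h
    refine h.mono ((continuous_P.measurable.comp hf).aestronglyMeasurable) (.of_forall fun ω => ?_)
    -- `‖P f‖² = ⟪f, P f⟫` makes `P` nonexpansive.
    have h₁ := inner_P_left (f ω) (P (f ω))
    rw [P_P, real_inner_self_eq_norm_sq] at h₁
    have h₂ := real_inner_le_norm (f ω) (P (f ω))
    rcases (norm_nonneg (P (f ω))).eq_or_lt with h₀ | h₀
    · rw [← h₀]
      exact norm_nonneg _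
    · nlinarith
  induction n with
  | zero => exact ⟨memLp_const _, memLp_const _⟩
  | succ n ih =>
    have hm := measurable_iterates p ha hb n
    have hm' := measurable_iterates p ha hb (n + 1)
    have hx' : MemLp (splitIterate p a b (n + 1)) 2 μ := by
      -- `R_0` need not be positive semidefinite, so the norm estimate starts at `n = 1`; the
      -- iterate with index `1` is deterministic.
      rcases Nat.eq_zero_or_pos n with rfl | hn
      · have e : splitIterate p a b 1 = fun _ => pair
            (mulVec (1 + p.lam • p.R0)⁻¹ ((p.α • P p.x0 + (1 - p.α) • p.x0).fst + p.lam • p.r0))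
            (soft (p.lam * p.ρ) (p.α • P p.x0 + (1 - p.α) • p.x0).snd) := rfl
        rw [zero_add, e]
        exact memLp_const _
      · rw [memLp_two_iff_integrable_sq_norm hm'.1.aestronglyMeasurable]
        have hh : Integrable (fun ω => ‖halfIterate p a b n ω‖ ^ 2) μ :=
          (memLp_two_iff_integrable_sq_norm hm.2.aestronglyMeasurable).1 ih.2
        have hB : Integrable (fun ω => ∑ ν ∈ Finset.Icc 1 n, b ν ω ^ 2) μ :=
          integrable_finsetSum _ fun ν hν => (hb' ν (Finset.mem_Icc.1 hν).1).integrable_sq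
        refine (hh.add (hB.const_mul (p.lam / (2 * n)))).mono'
          (hm'.1.norm.pow_const 2).aestronglyMeasurable (.of_forall fun ω => ?_)
        have h₁ := norm_sq_step_le p a b hn.ne' ω (halfIterate p a b n ω).fst
        have h₂ := pow_le_pow_left₀ (norm_nonneg _)
          (norm_soft_le (mul_pos p.lam_pos p.ρ_pos) (halfIterate p a b n ω).snd) 2
        rw [norm_pow, norm_norm, splitIterate_succ, WithLp.prod_norm_sq_eq_of_L2]
        have h₃ := WithLp.prod_norm_sq_eq_of_L2 (halfIterate p a b n ω)
        simp only [Pi.add_apply]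
        rw [h₃]
        change ‖mulVec _ _‖ ^ 2 + ‖soft _ _‖ ^ 2 ≤ _
        linarith
    refine ⟨hx', ?_⟩
    have e : halfIterate p a b (n + 1) = fun ω => _ := funext fun ω => halfIterate_succ p a b n ω
    rw [e]
    exact ((ih.2.sub ((hPL hm.1 ih.1).const_smul p.α)).sub (ih.1.const_smul (1 - p.α))).add
      (hPL hm'.1 hx')

theorem integrable_vartheta [MeasurableSpace Ω] {μ : Measure Ω} [IsProbabilityMeasure μ]
    (ha : ∀ n, 1 ≤ n → Measurable (a n)) (hb : ∀ n, 1 ≤ n → Measurable (b n))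
    (hb' : ∀ n, 1 ≤ n → MemLp (b n) 2 μ) (y : X D × X D) (n : ℕ) :
    Integrable (vartheta p a b y n) μ := by
  have hx := (memLp_iterates p ha hb hb' (n + 1)).1
  have hh := (memLp_iterates p ha hb hb' n).2
  have h₁ : MemLp (fun ω => y.1 - splitIterate p a b (n + 1) ω) 2 μ := (memLp_const _).sub hx
  have h₂ : MemLp (fun ω => p.lam⁻¹ • (halfIterate p a b n ω - splitIterate p a b (n + 1) ω)
      - -(p.lam⁻¹ • U y.2)) 2 μ := ((hh.sub hx).const_smul p.lam⁻¹).sub (memLp_const _)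
  have hm : AEStronglyMeasurable (vartheta p a b y n) μ :=
    ((stronglyMeasurable_vartheta p y n).mono ((iterateFiltration p ha hb).le (n + 1))).aestronglyMeasurable
  refine (((h₁.norm.integrable_mul h₂.norm)).const_mul (2 * p.lam)).mono' hm
    (.of_forall fun ω => ?_)
  have hl : 0 ≤ 2 * p.lam := by linarith [p.lam_pos]
  rw [vartheta, norm_mul, Real.norm_of_nonneg hl]
  exact mul_le_mul_of_nonneg_left (norm_inner_le_norm _ _) hl

end Measurability

end CRegLS

namespace CRegLS

/-! ### Pathwise convergence -/

section Pathwise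

theorem tendsto_zero_of_mul_norm_sq_le {V : Type*} [SeminormedAddCommGroup V] {f : ℕ → V}
    {d : ℕ → ℝ} {c : ℝ} (hc : 0 < c) (h : ∀ n, c * ‖f n‖ ^ 2 ≤ d n)
    (hd : Tendsto d atTop (𝓝 0)) : Tendsto f atTop (𝓝 0) := by
  have hs : Tendsto (fun n => √(d n / c)) atTop (𝓝 0) := by
    have := (hd.div_const c).sqrt
    rwa [zero_div, Real.sqrt_zero] at this
  refine squeeze_zero_norm (fun n => Real.le_sqrt_of_sq_le ?_) hs
  rw [le_div_iff₀ hc, mul_comm]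
  exact h n

variable {Ω : Type*} {D : ℕ} (p : Input D) {a : ℕ → Ω → E D} {b : ℕ → Ω → ℝ}
  {R : Matrix (Fin D) (Fin D) ℝ} {r : E D} {β : ℝ} {ω : Ω}

theorem norm_sq_P_sub_le_energy (y : X D × X D) (x w : X D) :
    ‖P x - y.1‖ ^ 2 ≤ energy p y x w := by
  have := one_sub_α_pos p
  have h₁ : 0 ≤ (1 - p.α) * ‖U x‖ ^ 2 := by positivity
  have h₂ : 0 ≤ ‖w - U y.2‖ ^ 2 / (1 - p.α) := by positivity
  unfold energy
  linarith

theorem mul_norm_sq_U_le_energy (y : X D × X D) (x w : X D) :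
    (1 - p.α) * ‖U x‖ ^ 2 ≤ energy p y x w := by
  have := one_sub_α_pos p
  have h₂ : 0 ≤ ‖w - U y.2‖ ^ 2 / (1 - p.α) := by positivity
  unfold energy
  linarith [sq_nonneg ‖P x - y.1‖]

theorem norm_sq_dual_sub_le_energy (y : X D × X D) (x w : X D) :
    ‖w - U y.2‖ ^ 2 ≤ (1 - p.α) * energy p y x w := by
  have hα := one_sub_α_pos p
  have h₁ : 0 ≤ (1 - p.α) * ‖U x‖ ^ 2 := by positivity
  rw [mul_comm, ← div_le_iff₀ hα]
  unfold energy
  linarith [sq_nonneg ‖P x - y.1‖]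

theorem continuous_energy_left (x w : X D) : Continuous fun y : X D × X D => energy p y x w := by
  have := continuous_U (D := D)
  unfold energy
  fun_prop

theorem continuous_energy_right (y : X D × X D) :
    Continuous fun q : X D × X D => energy p y q.1 q.2 := by
  have := continuous_U (D := D)
  have := continuous_P (D := D)
  unfold energy
  fun_prop

/-- All three terms of the dissipation are nonnegative with positive weights because `1/2 ≤ α < 1`.
-/
theorem tendsto_sub_succ_of_dissipation {x : ℕ → X D}
    (hd : Tendsto (fun n => dissipation p (x n) (x (n + 1))) atTop (𝓝 0)) :
    Tendsto (fun n => x n - x (n + 1)) atTop (𝓝 0) ∧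
      Tendsto (fun n => U (x (n + 1))) atTop (𝓝 0) := by
  have hα := one_sub_α_pos p
  have h₁ : ∀ n, 0 ≤ (1 - p.α) * ‖U (x n) - U (x (n + 1))‖ ^ 2 := fun n => by positivity
  have h₂ : ∀ n, 0 ≤ (1 - p.α) * ‖U (x (n + 1))‖ ^ 2 := fun n => by positivity
  have h₃ : ∀ n, 0 ≤ (2 * p.α - 1) * ‖U (x (n + 1))‖ ^ 2 := fun n =>
    mul_nonneg (by linarith [p.half_le_α]) (sq_nonneg _)
  have t₁ : Tendsto (fun n => P (x n) - P (x (n + 1))) atTop (𝓝 0) :=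
    tendsto_zero_of_mul_norm_sq_le one_pos (fun n => by
      unfold dissipation
      linarith [h₁ n, h₂ n, h₃ n]) hd
  have t₂ : Tendsto (fun n => U (x n) - U (x (n + 1))) atTop (𝓝 0) :=
    tendsto_zero_of_mul_norm_sq_le hα (fun n => by
      unfold dissipation
      linarith [sq_nonneg ‖P (x n) - P (x (n + 1))‖, h₂ n, h₃ n]) hd
  have t₃ : Tendsto (fun n => U (x (n + 1))) atTop (𝓝 0) :=
    tendsto_zero_of_mul_norm_sq_le hα (fun n => by
      unfold dissipation
      linarith [sq_nonneg ‖P (x n) - P (x (n + 1))‖, h₁ n, h₃ n]) hd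
  refine ⟨?_, t₃⟩
  have t := t₁.add t₂
  rw [add_zero] at t
  refine t.congr fun n => ?_
  rw [← P_sub, ← U_sub, P_add_U]

/-- Cluster points of the primal-dual iterates lie in `Υ_*`. -/
theorem mem_Upsilon_of_tendsto
    (hsymm : ∀ x y : E D, inner ℝ x (mulVec R y) = inner ℝ y (mulVec R x))
    (hnonneg : ∀ x : E D, 0 ≤ inner ℝ x (mulVec R x))
    (hR : Tendsto (fun n => Rn p a n ω) atTop (𝓝 R))
    (hr : Tendsto (fun n => rn p a b n ω) atTop (𝓝 r))
    (hd : Tendsto (fun n => dissipation p (splitIterate p a b n ω) (splitIterate p a b (n + 1) ω))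
      atTop (𝓝 0))
    {φ : ℕ → ℕ} (hφ : StrictMono φ) {x w : X D}
    (hx : Tendsto (fun k => splitIterate p a b (φ k) ω) atTop (𝓝 x))
    (hw : Tendsto (fun k => dualIterate p a b (φ k) ω) atTop (𝓝 w)) :
    P x = x ∧ U w = w ∧ (x, w) ∈ Upsilon p R r β := by
  have hφ' := hφ.tendsto_atTop
  obtain ⟨hs, hU⟩ := tendsto_sub_succ_of_dissipation p hd
  have hx' : Tendsto (fun k => splitIterate p a b (φ k + 1) ω) atTop (𝓝 x) := by
    have := hx.sub (hs.comp hφ')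
    rw [sub_zero] at this
    exact this.congr fun k => sub_sub_cancel _ _
  have hUx : U x = 0 :=
    tendsto_nhds_unique ((continuous_U.tendsto x).comp hx') (hU.comp hφ')
  have hPx : P x = x := by
    have := P_add_U x
    rwa [hUx, add_zero] at this
  have hPw : P w = 0 :=
    tendsto_nhds_unique ((continuous_P.tendsto w).comp hw)
      (tendsto_const_nhds.congr fun k => (P_dualIterate p a b (φ k) ω).symm)
  -- The relaxed projection fixes the diagonal, so the half iterates tend to `x - w`.
  have hhalf : Tendsto (fun k => halfIterate p a b (φ k) ω) atTop (𝓝 (x - w)) := by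
    have h := ((((continuous_P.tendsto x).comp hx).const_smul p.α).add
      (hx.const_smul (1 - p.α))).sub hw
    have e : p.α • P x + (1 - p.α) • x = x := by
      rw [hPx]
      module
    rw [e] at h
    exact h.congr fun k => (halfIterate_eq p a b (φ k) ω).symm
  have c₁ : Continuous fun z : X D => z.fst := by fun_prop
  have c₂ : Continuous fun z : X D => z.snd := by fun_prop
  have hhalf₁ := (c₁.tendsto _).comp hhalf
  have hhalf₂ := (c₂.tendsto _).comp hhalf
  have hx₁ := (c₁.tendsto _).comp hx'
  have hx₂ := (c₂.tendsto _).comp hx'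
  -- The limit is taken in the normal equation, not in the inverse; index `0` is discarded because
  -- `R_0` is arbitrary.
  have e₁ : x.fst + p.lam • mulVec R x.fst = (x - w).fst + p.lam • r := by
    have hM := (continuous_mulVec.tendsto (R, x.fst)).comp ((hR.comp hφ').prodMk_nhds hx₁)
    refine tendsto_nhds_unique_of_eventuallyEq (hx₁.add (hM.const_smul p.lam))
      (hhalf₁.add ((hr.comp hφ').const_smul p.lam)) ?_
    filter_upwards [hφ'.eventually_ne_atTop 0] with k hk
    exact mulVec_inv_cancel p a hk ω _
  have e₂ : ∀ z, p.lam * p.ρ * l1 x.snd + inner ℝ ((x - w).snd - x.snd) (z - x.snd) ≤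
      p.lam * p.ρ * l1 z := fun z =>
    le_of_tendsto_of_tendsto'
      ((((continuous_l1.tendsto _).comp hx₂).const_mul (p.lam * p.ρ)).add
        ((hhalf₂.sub hx₂).inner (hx₂.const_sub z))) tendsto_const_nhds
      fun k => soft_subgradient (mul_pos p.lam_pos p.ρ_pos) (halfIterate p a b (φ k) ω).snd z
  have hUw := U_eq_self hPw
  have hlam := p.lam_pos
  refine ⟨hPx, hUw, ?_, ?_⟩
  · change x.fst = x.snd
    rw [← hPx, fst_P, snd_P]
  change -(p.lam⁻¹ • U w) ∈ subdifferential _ x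
  rw [hUw]
  refine mem_subdifferential_splitObjective hsymm hnonneg r β p.ρ ?_ fun z => ?_
  · have h : -w.fst = p.lam • (mulVec R x.fst - r) := by
      rw [WithLp.sub_fst] at e₁
      calc -w.fst = (x.fst - w.fst + p.lam • r) - x.fst - p.lam • r := by abel
        _ = p.lam • (mulVec R x.fst - r) := by
          rw [← e₁, smul_sub]
          abel
    rw [WithLp.neg_fst, WithLp.smul_fst, ← smul_neg, h, inv_smul_smul₀ hlam.ne']
  · have h := e₂ z
    have e : (x - w).snd - x.snd = -w.snd := by
      rw [WithLp.sub_snd]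
      abel
    rw [e] at h
    rw [WithLp.neg_snd, WithLp.smul_snd, ← smul_neg, real_inner_smul_left]
    refine le_of_mul_le_mul_left (?_ : p.lam * _ ≤ p.lam * _) hlam
    rw [mul_add, mul_inv_cancel_left₀ hlam.ne', ← mul_assoc, ← mul_assoc]
    exact h

/-- A convergent energy is bounded, and it controls `P x_n`, `U x_n` and `w_n`, hence both
sequences. -/
theorem exists_subseq_tendsto_of_energy {y : X D × X D} {l : ℝ}
    (hl : Tendsto (fun n => energy p y (splitIterate p a b n ω) (dualIterate p a b n ω))
      atTop (𝓝 l)) :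
    ∃ q : X D × X D, ∃ φ : ℕ → ℕ, StrictMono φ ∧
      Tendsto (fun k => (splitIterate p a b (φ k) ω, dualIterate p a b (φ k) ω)) atTop (𝓝 q) := by
  have hα := one_sub_α_pos p
  obtain ⟨M, hM⟩ := hl.bddAbove_range
  replace hM : ∀ n, energy p y (splitIterate p a b n ω) (dualIterate p a b n ω) ≤ M :=
    fun n => hM ⟨n, rfl⟩
  have hbx : ∀ n, ‖splitIterate p a b n ω‖ ≤ √M + ‖y.1‖ + √(M / (1 - p.α)) := by
    intro n
    have h₁ := Real.le_sqrt_of_sq_le ((norm_sq_P_sub_le_energy p y _ _).trans (hM n))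
    have h₂ : ‖U (splitIterate p a b n ω)‖ ≤ √(M / (1 - p.α)) := by
      refine Real.le_sqrt_of_sq_le ?_
      rw [le_div_iff₀ hα, mul_comm]
      exact (mul_norm_sq_U_le_energy p y _ _).trans (hM n)
    have h₃ := norm_add_le (P (splitIterate p a b n ω)) (U (splitIterate p a b n ω))
    rw [P_add_U] at h₃
    have h₄ := norm_add_le (P (splitIterate p a b n ω) - y.1) y.1
    rw [sub_add_cancel] at h₄
    linarith
  have hbw : ∀ n, ‖dualIterate p a b n ω‖ ≤ √((1 - p.α) * M) + ‖U y.2‖ := by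
    intro n
    have h₁ := Real.le_sqrt_of_sq_le ((norm_sq_dual_sub_le_energy p y _ _).trans
      (mul_le_mul_of_nonneg_left (hM n) hα.le))
    have h₄ := norm_add_le (dualIterate p a b n ω - U y.2) (U y.2)
    rw [sub_add_cancel] at h₄
    linarith
  obtain ⟨q, -, φ, hφ, hlim⟩ := tendsto_subseq_of_bounded
    ((Metric.isBounded_closedBall (x := (0 : X D)) (r := √M + ‖y.1‖ + √(M / (1 - p.α)))).prod
      (Metric.isBounded_closedBall (x := (0 : X D)) (r := √((1 - p.α) * M) + ‖U y.2‖)))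
    (x := fun n => (splitIterate p a b n ω, dualIterate p a b n ω))
    fun n => ⟨mem_closedBall_zero_iff.2 (hbx n), mem_closedBall_zero_iff.2 (hbw n)⟩
  exact ⟨q, φ, hφ, hlim⟩

/-- Opial's argument with an approximate centre: choose `S i` so close to the cluster point that its
energy there is small. The energy at `S i` converges, and along the subsequence to that small value,
so it is eventually small along the whole sequence; the triangle inequality through `S i` concludes.
-/
theorem tendsto_P_of_energy {S : ℕ → X D × X D} {x w : X D} (hPx : P x = x) (hUw : U w = w)
    (hS : (x, w) ∈ closure (Set.range S)) {u v : ℕ → X D}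
    (henergy : ∀ i, ∃ l, Tendsto (fun n => energy p (S i) (u n) (v n)) atTop (𝓝 l))
    {φ : ℕ → ℕ} (hφ : StrictMono φ)
    (hlim : Tendsto (fun k => (u (φ k), v (φ k))) atTop (𝓝 (x, w))) :
    Tendsto (fun n => P (u n)) atTop (𝓝 x) := by
  have hUx : U x = 0 := by rw [U, hPx, sub_self]
  have hzero : energy p (x, w) x w = 0 := by
    simp [energy, hPx, hUw, hUx]
  rw [Metric.tendsto_atTop']
  intro ε hε
  have hδ : 0 < (ε / 2) ^ 2 := by positivity
  have hopen : IsOpen {z : X D × X D | energy p z x w < (ε / 2) ^ 2} :=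
    isOpen_lt (continuous_energy_left p x w) continuous_const
  obtain ⟨_, hi, i, rfl⟩ := mem_closure_iff.1 hS _ hopen (hzero.trans_lt hδ)
  rw [Set.mem_ofPred_eq] at hi
  obtain ⟨l, hl⟩ := henergy i
  have hsub : Tendsto (fun k => energy p (S i) (u (φ k)) (v (φ k))) atTop
      (𝓝 (energy p (S i) x w)) := by
    have h := ((continuous_energy_right p (S i)).tendsto (x, w)).comp hlim
    exact h
  rw [tendsto_nhds_unique (hl.comp hφ.tendsto_atTop) hsub] at hl
  obtain ⟨N, hN⟩ := (hl.eventually_lt_const hi).exists_forall_of_atTop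
  refine ⟨N, fun n hn => ?_⟩
  have hε' : 0 ≤ ε / 2 := by positivity
  have h₁ := lt_of_pow_lt_pow_left₀ 2 hε'
    ((norm_sq_P_sub_le_energy p (S i) _ _).trans_lt (hN n hn.le))
  have h₂ := lt_of_pow_lt_pow_left₀ 2 hε' ((norm_sq_P_sub_le_energy p (S i) x w).trans_lt hi)
  rw [hPx] at h₂
  rw [← dist_eq_norm] at h₁ h₂
  have := dist_triangle_right (P (u n)) x (S i).1
  linarith

theorem exists_tendsto_output
    (hsymm : ∀ x y : E D, inner ℝ x (mulVec R y) = inner ℝ y (mulVec R x))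
    (hnonneg : ∀ x : E D, 0 ≤ inner ℝ x (mulVec R x))
    (hR : Tendsto (fun n => Rn p a n ω) atTop (𝓝 R))
    (hr : Tendsto (fun n => rn p a b n ω) atTop (𝓝 r))
    (hd : Tendsto (fun n => dissipation p (splitIterate p a b n ω) (splitIterate p a b (n + 1) ω))
      atTop (𝓝 0))
    (S : ℕ → Upsilon p R r β) (hS : DenseRange S)
    (henergy : ∀ i, ∃ l, Tendsto (fun n => energy p (S i) (splitIterate p a b n ω)
      (dualIterate p a b n ω)) atTop (𝓝 l)) :
    ∃ x, IsSolution R r β p.ρ x ∧ Tendsto (fun n => output p a b n ω) atTop (𝓝 x) := by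
  obtain ⟨l₀, hl₀⟩ := henergy 0
  obtain ⟨⟨x, w⟩, φ, hφ, hlim⟩ := exists_subseq_tendsto_of_energy p hl₀
  have hx : Tendsto (fun k => splitIterate p a b (φ k) ω) atTop (𝓝 x) :=
    hlim.fst_nhds
  have hw : Tendsto (fun k => dualIterate p a b (φ k) ω) atTop (𝓝 w) :=
    hlim.snd_nhds
  obtain ⟨hPx, hUw, hmem⟩ := mem_Upsilon_of_tendsto (β := β) p hsymm hnonneg hR hr hd hφ hx hw
  have hS' : (x, w) ∈ closure (Set.range fun i => (S i : X D × X D)) := by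
    have h := image_closure_subset_closure_image continuous_subtype_val
      ⟨(⟨(x, w), hmem⟩ : Upsilon p R r β), hS _, rfl⟩
    rwa [← Set.range_comp] at h
  have hsol := isSolution_of_mem_Upsilon p hmem
  dsimp only at hsol
  refine ⟨x.fst, hsol, ?_⟩
  have hP := tendsto_P_of_energy p hPx hUw hS' henergy hφ hlim
  have c₁ : Continuous fun z : X D => z.fst := by fun_prop
  -- The output is by definition the first component of `P x_n`.
  exact (c₁.tendsto x).comp hP

end Pathwise

/-! ### Almost sure convergence -/

section AlmostSure

variable {Ω : Type*} [MeasurableSpace Ω] {μ : Measure Ω} [IsProbabilityMeasure μ] {D : ℕ}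
  {θ : E D} {a : ℕ → Ω → E D} {b η : ℕ → Ω → ℝ} {R : Matrix (Fin D) (Fin D) ℝ} {r : E D} {β : ℝ}

theorem ae_tendsto_energy (hmodel : RegressionModel μ θ a b η R r β) (p : Input D)
    (hdominated : Dominated μ p a b R r β) {y : X D × X D} (hy : y ∈ Upsilon p R r β) :
    ∀ᵐ ω ∂μ, Tendsto (fun n => dissipation p (splitIterate p a b n ω)
        (splitIterate p a b (n + 1) ω)) atTop (𝓝 0) ∧
      ∃ l, Tendsto (fun n => energy p y (splitIterate p a b n ω) (dualIterate p a b n ω))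
        atTop (𝓝 l) := by
  obtain ⟨ψ, -, hψ0, hψ, hdom⟩ := hdominated y hy
  have ha := hmodel.measurable_a
  have hb := hmodel.measurable_b
  have hPy : P y.1 = y.1 := P_eq_self hy.1
  have hid := fun n ω => energy_add_sum_dissipation p a b hPy n ω
  have hdn := fun n ω => dissipation_nonneg p (splitIterate p a b n ω)
    (splitIterate p a b (n + 1) ω)
  have hen := fun n ω => energy_nonneg p y (splitIterate p a b n ω) (dualIterate p a b n ω)
  -- The initial energy is deterministic because `x_0` is fixed and `w_0 = 0`, so one constant
  -- serves all `ω`.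
  have hlower : ∀ n ω, -energy p y p.x0 0 ≤ ∑ k ∈ Finset.range n, vartheta p a b y k ω :=
    fun n ω => by
      have := Finset.sum_nonneg fun k (_ : k ∈ Finset.range n) => hdn k ω
      linarith [hid n ω, hen n ω]
  filter_upwards [ae_exists_tendsto_sum_of_condExp_dominated (iterateFiltration p ha hb)
    (vartheta p a b y) (integrable_vartheta p ha hb hmodel.memLp_b y)
    (stronglyMeasurable_vartheta p y) _ hlower ψ hψ hψ0 hdom] with ω ⟨l, hl⟩
  obtain ⟨B, hB⟩ := hl.bddAbove_range
  have hsum : Summable fun n => dissipation p (splitIterate p a b n ω)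
      (splitIterate p a b (n + 1) ω) := by
    refine summable_of_sum_range_le (c := energy p y p.x0 0 + B) (fun n => hdn n ω) fun n => ?_
    have : ∑ k ∈ Finset.range n, vartheta p a b y k ω ≤ B := hB ⟨n, rfl⟩
    linarith [hid n ω, hen n ω]
  refine ⟨hsum.tendsto_atTop_zero, _, ((hl.const_add (energy p y p.x0 0)).sub
    hsum.hasSum.tendsto_sum_nat).congr fun n => ?_⟩
  rw [← hid n ω, add_sub_cancel_right]

theorem ae_exists_tendsto_output (hmodel : RegressionModel μ θ a b η R r β) (p : Input D)
    (hergodic : PointwiseErgodic μ p a b R r) (hdominated : Dominated μ p a b R r β) :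
    ∀ᵐ ω ∂μ, ∃ x, IsSolution R r β p.ρ x ∧
      Tendsto (fun n => output p a b n ω) atTop (𝓝 x) := by
  have hsymm := hmodel.inner_mulVec_comm
  have hnonneg := hmodel.inner_mulVec_self_nonneg
  have : Nonempty (Upsilon p R r β) :=
    (Upsilon_nonempty p hsymm hnonneg hmodel.ensembleLoss_nonneg).to_subtype
  -- Countably many centres leave a single null set to discard.
  set S := TopologicalSpace.denseSeq (Upsilon p R r β)
  have hall := ae_all_iff.2 fun i => ae_tendsto_energy hmodel p hdominated (S i).2
  filter_upwards [hergodic.1, hergodic.2, hall] with ω hR hr hω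
  have hR' : Tendsto (fun n => Rn p a n ω) atTop (𝓝 R) := by
    simpa using hR.const_sub R
  have hr' : Tendsto (fun n => rn p a b n ω) atTop (𝓝 r) := by
    simpa using hr.const_sub r
  exact exists_tendsto_output p hsymm hnonneg hR' hr' (hω 0).1 S
    (TopologicalSpace.denseRange_denseSeq _) fun i => (hω i).2

end AlmostSure

end CRegLS

/-! ### Measurable choice of the limit -/

theorem corollary2 {Ω : Type*} [MeasurableSpace Ω] (μ : Measure Ω) [IsProbabilityMeasure μ]
    {D : ℕ} (θ : CRegLS.E D) (a : ℕ → Ω → CRegLS.E D) (b η : ℕ → Ω → ℝ)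
    (R : Matrix (Fin D) (Fin D) ℝ) (r : CRegLS.E D) (β : ℝ)
    (hmodel : CRegLS.RegressionModel μ θ a b η R r β)
    (p : CRegLS.Input D)
    (hergodic : CRegLS.PointwiseErgodic μ p a b R r)
    (hunbiased : CRegLS.AsymptoticallyUnbiased μ p a b R r β)
    (hdominated : CRegLS.Dominated μ p a b R r β) :
    ∃ xlim : Ω → CRegLS.E D, Measurable xlim ∧
      ∀ᵐ ω ∂μ, CRegLS.IsSolution R r β p.ρ (xlim ω) ∧
        Tendsto (fun n => CRegLS.output p a b n ω) atTop (𝓝 (xlim ω)) := by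
  have hconv := CRegLS.ae_exists_tendsto_output hmodel p hergodic hdominated
  have hmeas : ∀ n, AEMeasurable (CRegLS.output p a b n) μ := fun n =>
    (CRegLS.continuous_avg.measurable.comp (CRegLS.measurable_iterates p hmodel.measurable_a
      hmodel.measurable_b n).1).aemeasurable
  -- So far the limit is only chosen separately for each `ω`; measurability of the outputs gives a
  -- measurable version, and uniqueness of limits identifies the two almost everywhere.
  obtain ⟨xlim, hxm, hxlim⟩ := measurable_limit_of_tendsto_metrizable_ae hmeas
    (hconv.mono fun ω ⟨x, hx⟩ => ⟨x, hx.2⟩)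
  refine ⟨xlim, hxm, ?_⟩
  filter_upwards [hconv, hxlim] with ω ⟨x, hsol, hx⟩ hω
  rw [tendsto_nhds_unique hω hx]
  exact ⟨hsol, hx⟩
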